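/- Let $(M,g)$ be a connected, oriented and time-oriented smooth Lorentzian four-manifold of signature $(-,+,+,+)$ with a spin structure, and let $S$ be the associated bundle of irreducible real Clifford modules (rank four, Clifford multiplication normalized by $v\cdot v\cdot\varepsilon=g(v,v)\,\varepsilon$), with the connection $\nabla^g$ induced by the Levi-Civita connection. Let $\varepsilon$ be a smooth section of $S$, not identically zero, such that for some real constant $\lambda\neq 0$ $$\nabla^g_v\varepsilon=\tfrac{\lambda}{2}\,v\cdot\varepsilon\qquad\text{for all tangent vectors } v .$$ Then $(M,g)$ is locally isometric to an open subset of $\mathbb{R}^4$ with a metric of the following form. For every $p\in M$ there are smooth families, parametrized by $x_u\in\mathbb{R}$, of functions $\mathcal{H}_{x_u},\mathcal{F}_{x_u},\mathcal{G}_{x_u}$ and of one-forms $\beta_{x_u}$ on $X=\mathbb{R}^2$, such that $\mathrm{d}_X\mathcal{F}_{x_u}$ and $\mathrm{d}_X\mathcal{G}_{x_u}$ are everywhere linearly independent and $$\mathrm{d}_X\beta_{x_u}=\frac{e^{-\mathcal{F}_{x_u}}}{4\lambda^2}\,\big\langle\partial_{x_u}{\ast_{q_{x_u}}}\mathrm{d}_X\mathcal{F}_{x_u}+\ast_{q_{x_u}}\partial_{x_u}\mathrm{d}_X\mathcal{F}_{x_u},\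 \mathrm{d}_X\mathcal{F}_{x_u}\big\rangle_{q_{x_u}}\,\nu_{q_{x_u}},\qquad q_{x_u}=\frac{1}{4\lambda^2}\,\mathrm{d}_X\mathcal{F}_{x_u}\otimes\mathrm{d}_X\mathcal{F}_{x_u}+e^{\mathcal{F}_{x_u}}\,\mathrm{d}_X\mathcal{G}_{x_u}\otimes\mathrm{d}_X\mathcal{G}_{x_u},$$ and there is a diffeomorphism from an open neighbourhood of $p$ onto an open subset of $\mathbb{R}^4=\mathbb{R}^2\times X$, with coordinates $(x_u,x_v)$ on the first factor, under which $g$ becomes $$\mathcal{H}_{x_u}\,\mathrm{d}x_u\otimes\mathrm{d}x_u+e^{\mathcal{F}_{x_u}}\,\mathrm{d}x_u\odot(\mathrm{d}x_v+\beta_{x_u})+\frac{1}{4\lambda^2}\,\mathrm{d}_X\mathcal{F}_{x_u}\otimes\mathrm{d}_X\mathcal{F}_{x_u}+e^{\mathcal{F}_{x_u}}\,\mathrm{d}_X\mathcal{G}_{x_u}\otimes\mathrm{d}_X\mathcal{G}_{x_u}.$$ Here $\mathrm{d}_X$ is the exterior derivative on $X$, $a\odot b=a\otimes b+b\otimes a$,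 and $\ast_q,\langle\cdot,\cdot\rangle_q,\nu_q$ are the Hodge star, inner product and volume form of $q$ for the standard orientation of $X$. -/

import Mathlib

open scoped ContDiff Manifold

noncomputable section

namespace SusyKundt

/-! ### The Clifford algebra of signature `(-,+,+,+)` and its real spinor module -/

/-- The diagonal entries of the Minkowski form `diag(-1,1,1,1)`. -/
def eta (a : Fin 4) : ℝ := if a = 0 then -1 else 1

/-- The Minkowski quadratic form `-w₀² + w₁² + w₂² + w₃²` on `ℝ⁴`. -/
def minkowski : QuadraticForm ℝ (Fin 4 → ℝ) := QuadraticMap.weightedSumSquares ℝ eta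

/-- Real gamma matrices: `γ₀² = -1`, `γ₁² = γ₂² = γ₃² = 1`, pairwise anticommuting. -/
def gammaMat : Fin 4 → Matrix (Fin 4) (Fin 4) ℝ :=
  ![!![0, 1, 0, 0; -1, 0, 0, 0; 0, 0, 0, -1; 0, 0, 1, 0],
    !![0, 0, 1, 0; 0, 0, 0, 1; 1, 0, 0, 0; 0, 1, 0, 0],
    !![0, 1, 0, 0; 1, 0, 0, 0; 0, 0, 0, -1; 0, 0, -1, 0],
    !![1, 0, 0, 0; 0, -1, 0, 0; 0, 0, -1, 0; 0, 0, 0, 1]]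

/-- Clifford multiplication by `w = ∑ wᵃ eₐ` on the spinor module `ℝ⁴`. -/
def gamma : (Fin 4 → ℝ) →ₗ[ℝ] Matrix (Fin 4) (Fin 4) ℝ :=
  Fintype.linearCombination ℝ gammaMat

/-- The Clifford relation `γ(w)² = ⟨w, w⟩`. -/
theorem gamma_mul_self (w : Fin 4 → ℝ) :
    gamma w * gamma w = algebraMap ℝ (Matrix (Fin 4) (Fin 4) ℝ) (minkowski w) := by
  ext i j
  fin_cases i <;> fin_cases j <;>
    simp [gamma, Fintype.linearCombination_apply, gammaMat, minkowski, eta, Fin.sum_univ_four,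
      Matrix.mul_apply, QuadraticMap.weightedSumSquares_apply, Matrix.algebraMap_matrix_apply] <;>
    ring

/-- The representation of the Clifford algebra `Cl(3,1)` on `ℝ⁴`. -/
def spinRep : CliffordAlgebra minkowski →ₐ[ℝ] Matrix (Fin 4) (Fin 4) ℝ :=
  CliffordAlgebra.lift minkowski ⟨gamma, gamma_mul_self⟩

/-- The spinor module is irreducible: a subspace preserved by Clifford multiplication is trivial. -/
theorem spinorModule_irreducible (W : Submodule ℝ (Fin 4 → ℝ))
    (hW : ∀ a, ∀ s ∈ W, (gammaMat a).mulVec s ∈ W) : W = ⊥ ∨ W = ⊤ := by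
  have h0 := hW 0
  have h1 := hW 1
  have h2 := hW 2
  have h3 := hW 3
  by_cases hb : W = ⊥
  · exact Or.inl hb
  right
  obtain ⟨s, hs, hs0⟩ := W.ne_bot_iff.1 hb
  -- every component of an element of `W` sits in `W` as a multiple of the first basis vector
  have key : ∀ t ∈ W, t 0 • (Pi.single 0 1 : Fin 4 → ℝ) ∈ W := by
    intro t ht
    have e : t 0 • (Pi.single 0 1 : Fin 4 → ℝ) = (1 / 4 : ℝ) • (t + (gammaMat 3).mulVec t
        + (gammaMat 0).mulVec ((gammaMat 2).mulVec t)
        + (gammaMat 0).mulVec ((gammaMat 2).mulVec ((gammaMat 3).mulVec t))) := by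
      ext i
      fin_cases i <;>
        (simp [gammaMat, dotProduct, Fin.sum_univ_four, Matrix.vecHead, Matrix.vecTail]; try ring)
    rw [e]
    exact W.smul_mem _ (W.add_mem (W.add_mem (W.add_mem ht (h3 t ht)) (h0 _ (h2 t ht)))
      (h0 _ (h2 _ (h3 t ht))))
  have k1 : s 1 • (Pi.single 0 1 : Fin 4 → ℝ) ∈ W := by
    have := key _ (h2 s hs)
    simpa [gammaMat, Matrix.mulVec, dotProduct, Fin.sum_univ_four, Matrix.vecHead,
      Matrix.vecTail] using this
  have k2 : s 2 • (Pi.single 0 1 : Fin 4 → ℝ) ∈ W := by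
    have := key _ (h1 s hs)
    simpa [gammaMat, Matrix.mulVec, dotProduct, Fin.sum_univ_four, Matrix.vecHead,
      Matrix.vecTail] using this
  have k3 : s 3 • (Pi.single 0 1 : Fin 4 → ℝ) ∈ W := by
    have := key _ (h2 _ (h1 s hs))
    simpa [gammaMat, Matrix.mulVec, dotProduct, Fin.sum_univ_four, Matrix.vecHead,
      Matrix.vecTail] using this
  have hE : (Pi.single 0 1 : Fin 4 → ℝ) ∈ W := by
    by_contra hne
    apply hs0
    have z : ∀ c : ℝ, c • (Pi.single 0 1 : Fin 4 → ℝ) ∈ W → c = 0 := fun c hc => by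
      by_contra hc0
      exact hne ((W.smul_mem_iff hc0).1 hc)
    ext i
    fin_cases i
    · exact z _ (key s hs)
    · exact z _ k1
    · exact z _ k2
    · exact z _ k3
  rw [eq_top_iff]
  intro t _
  have e : t = t 0 • (Pi.single 0 1 : Fin 4 → ℝ)
      + t 1 • (gammaMat 2).mulVec (Pi.single 0 1)
      + t 2 • (gammaMat 1).mulVec (Pi.single 0 1)
      + t 3 • (gammaMat 1).mulVec ((gammaMat 2).mulVec (Pi.single 0 1)) := by
    ext i
    fin_cases i <;>
      simp [gammaMat, dotProduct, Fin.sum_univ_four]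
  rw [e]
  exact W.add_mem (W.add_mem (W.add_mem (W.smul_mem _ hE) (W.smul_mem _ (h2 _ hE)))
    (W.smul_mem _ (h1 _ hE))) (W.smul_mem _ (h1 _ (h2 _ hE)))

/-- The group `Spin₀(3,1)` acting on the spinor module. The elements of Mathlib's `spinGroup` are
the even products `x` of vectors with `reverse x * x = 1`; in signature `(-,+,+,+)` these are the
even products of unit vectors with an even number of timelike factors, that is, the identity
component of the spin group. -/
def spinZero : Submonoid (Matrix (Fin 4) (Fin 4) ℝ) :=
  (spinGroup minkowski).map (spinRep : CliffordAlgebra minkowski →* Matrix (Fin 4) (Fin 4) ℝ)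

/-! ### Lorentzian four-manifolds, spin structures and Killing spinors -/

section Manifold

variable (M : Type*) [TopologicalSpace M] [ChartedSpace (EuclideanSpace ℝ (Fin 4)) M]
  [IsManifold (𝓡 4) ∞ M]

/-- A smooth metric of signature `(-,+,+,+)`. -/
structure LorentzianMetric where
  /-- The scalar product on each tangent space. -/
  inner (x : M) : TangentSpace (𝓡 4) x →L[ℝ] TangentSpace (𝓡 4) x →L[ℝ] ℝ
  symm (x : M) (v w : TangentSpace (𝓡 4) x) : inner x v w = inner x w v
  lorentzian (x : M) : ∃ b : Fin 4 → TangentSpace (𝓡 4) x,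
    ∀ a c, inner x (b a) (b c) = if a = c then eta a else 0
  contMDiff : ContMDiff (𝓡 4)
    ((𝓡 4).prod 𝓘(ℝ, EuclideanSpace ℝ (Fin 4) →L[ℝ] EuclideanSpace ℝ (Fin 4) →L[ℝ] ℝ)) ∞
    (fun x ↦ Bundle.TotalSpace.mk'
      (EuclideanSpace ℝ (Fin 4) →L[ℝ] EuclideanSpace ℝ (Fin 4) →L[ℝ] ℝ) x (inner x))

variable {M}

/-- The derivative of a function in the direction of a tangent vector. -/
def dirDeriv (f : M → ℝ) (x : M) (v : TangentSpace (𝓡 4) x) : ℝ :=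
  mfderiv (𝓡 4) 𝓘(ℝ, ℝ) f x v

/-- The Levi-Civita connection of `g`, through the Koszul formula:
`g(∇_X Y, Z)` at the point `x`, for vector fields `X`, `Y`, `Z` that are smooth near `x`. -/
def koszul (g : LorentzianMetric M) (X Y Z : (x : M) → TangentSpace (𝓡 4) x) (x : M) : ℝ :=
  (1 / 2) *
    (dirDeriv (fun y ↦ g.inner y (Y y) (Z y)) x (X x)
      + dirDeriv (fun y ↦ g.inner y (X y) (Z y)) x (Y x)
      - dirDeriv (fun y ↦ g.inner y (X y) (Y y)) x (Z x)
      + g.inner x (VectorField.mlieBracket (𝓡 4) X Y x) (Z x)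
      - g.inner x (VectorField.mlieBracket (𝓡 4) X Z x) (Y x)
      - g.inner x (VectorField.mlieBracket (𝓡 4) Y Z x) (X x))

/-- A spin structure on `(M, g)`, given by an open cover with smooth orthonormal frames and a
`Spin₀(3,1)`-valued cocycle that lifts the transition functions of the frames. The frames then
change by elements of `SO₀(3,1)`, so they orient and time-orient `M`; conversely, the frames of
a spin structure of an oriented and time-oriented `(M, g)` are of this kind. -/
structure SpinStructure (g : LorentzianMetric M) (ι : Type*) where
  /-- The members of the cover. -/
  dom : ι → Set M
  isOpen_dom : ∀ i, IsOpen (dom i)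
  cover : ∀ x, ∃ i, x ∈ dom i
  /-- The frames. -/
  frame : ι → Fin 4 → (x : M) → TangentSpace (𝓡 4) x
  frame_smooth : ∀ i a, ContMDiffOn (𝓡 4) (𝓡 4).tangent ∞
    (fun x ↦ (⟨x, frame i a x⟩ : TangentBundle (𝓡 4) M)) (dom i)
  frame_orthonormal : ∀ i, ∀ x ∈ dom i, ∀ a c,
    g.inner x (frame i a x) (frame i c x) = if a = c then eta a else 0
  /-- The lifts of the transition functions. -/
  trans : ι → ι → M → Matrix (Fin 4) (Fin 4) ℝ
  trans_smooth : ∀ i j a b,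
    ContMDiffOn (𝓡 4) 𝓘(ℝ, ℝ) ∞ (fun x ↦ trans i j x a b) (dom i ∩ dom j)
  trans_mem : ∀ i j, ∀ x ∈ dom i ∩ dom j, trans i j x ∈ spinZero
  trans_cocycle : ∀ i j k, ∀ x ∈ dom i ∩ dom j ∩ dom k,
    trans i j x * trans j k x = trans i k x
  /-- If `frame j b = ∑ c, Λ c b • frame i c` then `trans i j` conjugates `γ_b` to
  `∑ c, Λ c b • γ_c`. -/
  trans_lift : ∀ i j, ∀ x ∈ dom i ∩ dom j, ∀ b,
    trans i j x * gammaMat b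
      = (∑ c, (eta c * g.inner x (frame i c x) (frame j b x)) • gammaMat c) * trans i j x

namespace SpinStructure

variable {g : LorentzianMetric M} {ι : Type*} (P : SpinStructure g ι)

/-- The components of a tangent vector in the `i`-th frame. -/
def coord (i : ι) (x : M) (v : TangentSpace (𝓡 4) x) (a : Fin 4) : ℝ :=
  eta a * g.inner x (P.frame i a x) v

/-- The components `g(∇_v e_b, e_a)` of the Levi-Civita connection in the `i`-th frame. -/
def connection (i : ι) (x : M) (v : TangentSpace (𝓡 4) x) (a b : Fin 4) : ℝ :=
  ∑ c, P.coord i x v c * koszul g (P.frame i c) (P.frame i b) (P.frame i a) x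

/-- A spinor: a smooth section of the vector bundle associated to the spin structure through the
representation of `Spin₀(3,1)` on the irreducible Clifford module `ℝ⁴`. -/
structure Spinor where
  /-- The components of the section over each member of the cover. -/
  comp : ι → M → (Fin 4 → ℝ)
  smooth : ∀ i, ContMDiffOn (𝓡 4) 𝓘(ℝ, Fin 4 → ℝ) ∞ (comp i) (P.dom i)
  compat : ∀ i j, ∀ x ∈ P.dom i ∩ P.dom j,
    comp i x = (P.trans i j x).mulVec (comp j x)

variable {P}

/-- Clifford multiplication `v · ε` over the `i`-th member of the cover. -/
def Spinor.cliffordMul (ε : P.Spinor) (i : ι) (x : M) (v : TangentSpace (𝓡 4) x) :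
    Fin 4 → ℝ :=
  (gamma (P.coord i x v)).mulVec (ε.comp i x)

/-- The spinorial Levi-Civita connection over the `i`-th member of the cover,
`∇_v ε = v(ε) + (1/4) ∑ g(∇_v e_b, e_a) γᵃ γᵇ ε`, with `γᵃ = η^{aa} γ_a`. -/
def Spinor.covDeriv (ε : P.Spinor) (i : ι) (x : M) (v : TangentSpace (𝓡 4) x) :
    Fin 4 → ℝ :=
  let dε : Fin 4 → ℝ := mfderiv (𝓡 4) 𝓘(ℝ, Fin 4 → ℝ) (ε.comp i) x v
  dε + ((1 / 4 : ℝ) • ∑ a, ∑ b, (P.connection i x v a b * eta a * eta b) •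
        (gammaMat a * gammaMat b)).mulVec (ε.comp i x)

/-- `ε` is a real Killing spinor with Killing constant `lam`: it is not identically zero,
`lam ≠ 0`, and `∇_v ε = (lam/2) v · ε` for all tangent vectors `v`. -/
structure Spinor.IsKilling (ε : P.Spinor) (lam : ℝ) : Prop where
  const_ne_zero : lam ≠ 0
  nontrivial : ∃ i, ∃ x ∈ P.dom i, ε.comp i x ≠ 0
  killing : ∀ i, ∀ x ∈ P.dom i, ∀ v : TangentSpace (𝓡 4) x,
    ε.covDeriv i x v = (lam / 2) • ε.cliffordMul i x v

end SpinStructure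

end Manifold

/-! ### Families of tensors on the plane `X = ℝ²`, in Cartesian coordinates -/

/-- The differential `d_X f`, as the list of its components. -/
def dX (f : (Fin 2 → ℝ) → ℝ) (y : Fin 2 → ℝ) : Fin 2 → ℝ :=
  fun i ↦ fderiv ℝ f y (Pi.single i 1)

/-- The component along `dy₀ ∧ dy₁` of the exterior derivative `d_X β` of a one-form. -/
def dXOneForm (β : (Fin 2 → ℝ) → (Fin 2 → ℝ)) (y : Fin 2 → ℝ) : ℝ :=
  dX (fun z ↦ β z 1) y 0 - dX (fun z ↦ β z 0) y 1

/-- The inner product of covectors with respect to a metric with matrix `q`. -/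
def coInner (q : Matrix (Fin 2) (Fin 2) ℝ) (α β : Fin 2 → ℝ) : ℝ :=
  dotProduct α (q⁻¹.mulVec β)

/-- The component along `dy₀ ∧ dy₁` of the Riemannian volume form. -/
def volumeCoeff (q : Matrix (Fin 2) (Fin 2) ℝ) : ℝ := Real.sqrt q.det

/-- The Hodge star on covectors, `∗α = ι_{α♯} ν`, for the orientation `dy₀ ∧ dy₁`. -/
def hodge (q : Matrix (Fin 2) (Fin 2) ℝ) (α : Fin 2 → ℝ) : Fin 2 → ℝ :=
  ![-(volumeCoeff q * q⁻¹.mulVec α 1), volumeCoeff q * q⁻¹.mulVec α 0]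

/-- The matrix of `q_{x_u} = (1/4λ²) d_X F ⊗ d_X F + e^F d_X G ⊗ d_X G` at `y`. -/
def planeMetric (lam : ℝ) (F G : ℝ → (Fin 2 → ℝ) → ℝ) (u : ℝ) (y : Fin 2 → ℝ) :
    Matrix (Fin 2) (Fin 2) ℝ :=
  Matrix.of fun i j ↦ 1 / (4 * lam ^ 2) * (dX (F u) y i * dX (F u) y j)
    + Real.exp (F u y) * (dX (G u) y i * dX (G u) y j)

/-- The equation
`d_X β = (e^{-F}/4λ²) ⟨∂_{x_u} ∗ d_X F + ∗ ∂_{x_u} d_X F, d_X F⟩_q ν_q`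
for the family of one-forms `β`, where `q` is the family `planeMetric lam F G`. -/
def BetaEquation (lam : ℝ) (F G : ℝ → (Fin 2 → ℝ) → ℝ) (β : ℝ → (Fin 2 → ℝ) → (Fin 2 → ℝ)) :
    Prop :=
  ∀ u y, dXOneForm (β u) y =
    Real.exp (-F u y) / (4 * lam ^ 2) *
      coInner (planeMetric lam F G u y)
        (deriv (fun t ↦ hodge (planeMetric lam F G t y) (dX (F t) y)) u
          + hodge (planeMetric lam F G u y) (deriv (fun t ↦ dX (F t) y) u))
        (dX (F u) y) *
      volumeCoeff (planeMetric lam F G u y)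

/-- The metric
`H dx_u ⊗ dx_u + e^F dx_u ⊙ (dx_v + β) + (1/4λ²) d_X F ⊗ d_X F + e^F d_X G ⊗ d_X G`
on `ℝ⁴` with coordinates `(x_u, x_v, y₀, y₁)`, where `a ⊙ b = a ⊗ b + b ⊗ a`. -/
def kundtMetric (lam : ℝ) (H F G : ℝ → (Fin 2 → ℝ) → ℝ) (β : ℝ → (Fin 2 → ℝ) → (Fin 2 → ℝ))
    (p v w : EuclideanSpace ℝ (Fin 4)) : ℝ :=
  let u := p 0
  let y : Fin 2 → ℝ := ![p 2, p 3]
  let v' : Fin 2 → ℝ := ![v 2, v 3]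
  let w' : Fin 2 → ℝ := ![w 2, w 3]
  H u y * (v 0 * w 0)
    + Real.exp (F u y) * (v 0 * (w 1 + dotProduct (β u y) w') + (v 1 + dotProduct (β u y) v') * w 0)
    + 1 / (4 * lam ^ 2) * (dotProduct (dX (F u) y) v' * dotProduct (dX (F u) y) w')
    + Real.exp (F u y) * (dotProduct (dX (G u) y) v' * dotProduct (dX (G u) y) w')

end SusyKundt

end

open SusyKundt

/-!
For a Killing spinor `s`, the Dirac current `κ`, the bilinears `l` and `m` that span the screen
directions (rescaled by `|s| ^ (-2)`) and the opposite null form `n` (rescaled by `|s| ^ (-4)`) are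
a null coframe: the metric is `κ ⊙ n + l ⊗ l + m ⊗ m`. The spinor has no zeros, because the Killing
equation is a linear ODE along segments and the manifold is connected. The Killing equation gives
`dκ = 2λ l ∧ κ`, `dl = α ∧ κ`, `dm = λ l ∧ m + β ∧ κ` and `dn = -α ∧ l - β ∧ m` for some one-forms
`α` and `β`.

So `κ` is integrable and `l` is closed along its leaves. By the Frobenius theorem and the Poincaré
lemma along the leaves, a null rotation, which adds multiples of `κ` to `l` and `m`, makes
`l = dF / (2λ)`, `κ = e ^ F du` and `m = e ^ (F / 2) dG`; the rotated `n` is then `dv + H du`. With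
`u, v, F, G` as coordinates the metric has the required form with `F` and `G` the coordinate
functions of `X` and `β = 0`; for these families both sides of the equation for `dβ` vanish.

Smooth dependence in the Frobenius theorem comes from the implicit function theorem on the space of
continuous curves.
-/

noncomputable section

open Filter Topology Set

universe u

namespace SusyKundt

/-! ### Functions smooth near a point -/

section SmoothNear

variable {E F G : Type*} [NormedAddCommGroup E] [NormedSpace ℝ E]
  [NormedAddCommGroup F] [NormedSpace ℝ F] [NormedAddCommGroup G] [NormedSpace ℝ G]

/-- Smoothness on a neighbourhood of `a`. This is stronger than `ContDiffAt ℝ ∞ f a`, which only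
provides a neighbourhood of `C^n`-smoothness for each finite `n`. -/
def SmoothNear (f : E → F) (a : E) : Prop := ∀ᶠ x in 𝓝 a, ContDiffAt ℝ ∞ f x

theorem smoothNear_of_contDiff {f : E → F} (hf : ContDiff ℝ ∞ f) (a : E) : SmoothNear f a :=
  Eventually.of_forall fun _ => hf.contDiffAt

theorem smoothNear_const (c : F) (a : E) : SmoothNear (fun _ => c) a :=
  smoothNear_of_contDiff contDiff_const a

namespace SmoothNear

variable {f : E → F} {a : E}

theorem contDiffAt (hf : SmoothNear f a) : ContDiffAt ℝ ∞ f a :=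
  hf.self_of_nhds

theorem continuousAt (hf : SmoothNear f a) : ContinuousAt f a :=
  hf.contDiffAt.continuousAt

theorem differentiableAt (hf : SmoothNear f a) : DifferentiableAt ℝ f a :=
  hf.contDiffAt.differentiableAt (by simp)

theorem eventually_differentiableAt (hf : SmoothNear f a) :
    ∀ᶠ x in 𝓝 a, DifferentiableAt ℝ f x :=
  hf.mono fun _ hx => hx.differentiableAt (by simp)

protected theorem comp {g : F → G} (hg : SmoothNear g (f a)) (hf : SmoothNear f a) :
    SmoothNear (fun x => g (f x)) a := by
  filter_upwards [hf, hf.continuousAt.eventually hg] with x hfx hgx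
  exact hgx.comp x hfx

theorem prodMk {g : E → G} (hf : SmoothNear f a) (hg : SmoothNear g a) :
    SmoothNear (fun x => (f x, g x)) a := by
  filter_upwards [hf, hg] with x hfx hgx
  exact hfx.prodMk hgx

protected theorem fderiv (hf : SmoothNear f a) : SmoothNear (fderiv ℝ f) a := by
  filter_upwards [hf] with x hx
  exact hx.fderiv_right (m := ∞) (by simp)

theorem clm_apply {A : E → F →L[ℝ] G} (hA : SmoothNear A a) (hf : SmoothNear f a) :
    SmoothNear (fun x => A x (f x)) a := by
  filter_upwards [hA, hf] with x hAx hfx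
  exact hAx.clm_apply hfx

theorem sub {g : E → F} (hf : SmoothNear f a) (hg : SmoothNear g a) :
    SmoothNear (fun x => f x - g x) a := by
  filter_upwards [hf, hg] with x hfx hgx
  exact hfx.sub hgx

theorem smul {c : E → ℝ} (hc : SmoothNear c a) (hf : SmoothNear f a) :
    SmoothNear (fun x => c x • f x) a := by
  filter_upwards [hc, hf] with x hcx hfx
  exact hcx.smul hfx

theorem mul {c d : E → ℝ} (hc : SmoothNear c a) (hd : SmoothNear d a) :
    SmoothNear (fun x => c x * d x) a :=
  hc.smul hd

theorem inv {c : E → ℝ} (hc : SmoothNear c a) (ha : c a ≠ 0) :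
    SmoothNear (fun x => (c x)⁻¹) a := by
  filter_upwards [hc, hc.continuousAt.eventually_ne ha] with x hx hne
  exact hx.inv hne

theorem exp {c : E → ℝ} (hc : SmoothNear c a) : SmoothNear (fun x => Real.exp (c x)) a := by
  filter_upwards [hc] with x hx
  exact hx.exp

theorem exists_contDiff_eventuallyEq [FiniteDimensional ℝ E] (hf : SmoothNear f a) :
    ∃ g : E → F, ContDiff ℝ ∞ g ∧ g =ᶠ[𝓝 a] f := by
  obtain ⟨r, hr, hball⟩ := Metric.eventually_nhds_iff_ball.1 hf
  let χ : ContDiffBump a := ⟨r / 4, r / 2, by positivity, by linarith⟩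
  refine ⟨fun x => χ x • f x, contDiff_iff_contDiffAt.2 fun x => ?_, ?_⟩
  · by_cases hx : x ∈ Metric.ball a r
    · exact χ.contDiff.contDiffAt.smul (hball x hx)
    · have hxr : x ∈ (Metric.closedBall a (r / 2))ᶜ := fun hx' =>
        hx (Metric.closedBall_subset_ball (by linarith) hx')
      have hzero : (fun x => χ x • f x) =ᶠ[𝓝 x] fun _ => 0 := by
        filter_upwards [Metric.isClosed_closedBall.isOpen_compl.mem_nhds hxr] with y hy
        rw [χ.zero_of_le_dist (not_le.1 (Metric.mem_closedBall.not.1 hy)).le, zero_smul]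
      exact contDiffAt_const.congr_of_eventuallyEq hzero
  · filter_upwards [χ.eventuallyEq_one] with x hx
    simp [hx]

theorem exists_openPartialHomeomorph [CompleteSpace E] (hf : SmoothNear f a) (f' : E ≃L[ℝ] F)
    (hf' : HasFDerivAt f (f' : E →L[ℝ] F) a) :
    ∃ Θ : OpenPartialHomeomorph E F, (Θ : E → F) = f ∧ a ∈ Θ.source ∧
      (∀ x ∈ Θ.source, ContDiffAt ℝ ∞ f x) ∧ ∀ y ∈ Θ.target, ContDiffAt ℝ ∞ Θ.symm y := by
  have hn : (∞ : WithTop ℕ∞) ≠ 0 := by simp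
  let Θ₀ := hf.contDiffAt.toOpenPartialHomeomorph f hf' hn
  have hinv : ∀ᶠ x in 𝓝 a, ∃ e : E ≃L[ℝ] F, (e : E →L[ℝ] F) = fderiv ℝ f x :=
    hf.fderiv.continuousAt.eventually (hf'.fderiv ▸ ContinuousLinearEquiv.nhds f')
  obtain ⟨W, hW, hWo, haW⟩ := eventually_nhds_iff.1 (hf.and hinv)
  let Θ := Θ₀.restrOpen W hWo
  have hsource : Θ.source = Θ₀.source ∩ W := Θ₀.restrOpen_source W hWo
  refine ⟨Θ, rfl, ?_, fun x hx => (hW x (hsource ▸ hx).2).1, fun y hy => ?_⟩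
  · rw [hsource]
    exact ⟨hf.contDiffAt.mem_toOpenPartialHomeomorph_source hf' hn, haW⟩
  · obtain ⟨hsmooth, e, he⟩ := hW _ (hsource ▸ Θ.map_target hy).2
    exact Θ.contDiffAt_symm hy (f₀' := e)
      (he ▸ (hsmooth.differentiableAt (by simp)).hasFDerivAt) hsmooth

theorem exists_implicit [CompleteSpace E] [CompleteSpace F] {N : E × F → G}
    {p : E} {z : F} (hN : SmoothNear N (p, z)) (h0 : N (p, z) = 0) (e : F ≃L[ℝ] G)
    (he : ∀ h, fderiv ℝ N (p, z) (0, h) = e h) :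
    ∃ γ : E → F, SmoothNear γ p ∧ γ p = z ∧ ∀ᶠ q in 𝓝 p, N (q, γ q) = 0 := by
  let D := fderiv ℝ N (p, z)
  let T : (E × F) ≃L[ℝ] (E × G) :=
    (ContinuousLinearEquiv.refl ℝ E).skewProd e (D.comp (ContinuousLinearMap.inl ℝ E F))
  have hgraph : SmoothNear (fun w : E × F => (w.1, N w)) (p, z) :=
    (smoothNear_of_contDiff contDiff_fst _).prodMk hN
  have hderiv : HasFDerivAt (fun w : E × F => (w.1, N w)) (T : E × F →L[ℝ] E × G) (p, z) := by
    refine (hasFDerivAt_fst.prodMk hN.differentiableAt.hasFDerivAt).congr_fderiv ?_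
    ext w <;> simp [T, D, he]
  obtain ⟨Θ, hΘ, hsource, -, hsymm⟩ := hgraph.exists_openPartialHomeomorph T hderiv
  have hΘp : Θ (p, z) = (p, 0) := by rw [hΘ]; simp [h0]
  have hmem : (p, (0 : G)) ∈ Θ.target := hΘp ▸ Θ.map_source hsource
  have htarget : ∀ᶠ q in 𝓝 p, (q, (0 : G)) ∈ Θ.target :=
    (Continuous.prodMk_left (0 : G)).continuousAt.eventually (Θ.open_target.mem_nhds hmem)
  refine ⟨fun q => (Θ.symm (q, 0)).2, ?_, ?_, ?_⟩
  · filter_upwards [htarget] with q hq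
    exact contDiffAt_snd.comp q
      (ContDiffAt.comp q (hsymm _ hq) (contDiffAt_id.prodMk contDiffAt_const))
  · simp only [← hΘp, Θ.left_inv hsource]
  · filter_upwards [htarget] with q hq
    have hright : ((Θ.symm (q, 0)).1, N (Θ.symm (q, 0))) = (q, 0) := by
      simpa only [hΘ] using Θ.right_inv hq
    have hpair : (q, (Θ.symm (q, 0)).2) = Θ.symm (q, 0) :=
      Prod.ext (congrArg Prod.fst hright).symm rfl
    rw [hpair]
    exact congrArg Prod.snd hright

end SmoothNear

end SmoothNear

/-! ### Superposition operators on spaces of continuous functions -/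

section Superposition

variable {K : Type*} [TopologicalSpace K] [CompactSpace K]

/-- Pointwise application of a continuous family of linear maps to a continuous family of vectors,
as a bounded bilinear map. -/
def pointwiseApply (K : Type*) [TopologicalSpace K] [CompactSpace K]
    (E F : Type*) [NormedAddCommGroup E] [NormedSpace ℝ E] [NormedAddCommGroup F]
    [NormedSpace ℝ F] : C(K, E →L[ℝ] F) →L[ℝ] C(K, E) →L[ℝ] C(K, F) :=
  LinearMap.mkContinuous₂
    (LinearMap.mk₂ ℝ (fun (A : C(K, E →L[ℝ] F)) (h : C(K, E)) =>
        (⟨fun t => A t (h t), A.continuous.clm_apply h.continuous⟩ : C(K, F)))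
      (fun _ _ _ => by ext; simp) (fun _ _ _ => by ext; simp)
      (fun _ _ _ => by ext; simp) (fun _ _ _ => by ext; simp)) 1
    (fun A h => by
      rw [ContinuousMap.norm_le _ (by positivity), one_mul]
      intro t
      exact ((A t).le_opNorm _).trans
        (mul_le_mul (A.norm_coe_le_norm t) (h.norm_coe_le_norm t) (norm_nonneg _) (by positivity)))

@[simp] theorem pointwiseApply_apply {E F : Type*} [NormedAddCommGroup E] [NormedSpace ℝ E]
    [NormedAddCommGroup F] [NormedSpace ℝ F] (A : C(K, E →L[ℝ] F)) (h : C(K, E)) (t : K) :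
    pointwiseApply K E F A h t = A t (h t) := rfl

theorem hasFDerivAt_superposition {E F : Type*} [NormedAddCommGroup E] [NormedSpace ℝ E]
    [NormedAddCommGroup F] [NormedSpace ℝ F] {f : C(E, F)} {f' : C(E, E →L[ℝ] F)}
    (hf : ∀ x, HasFDerivAt f (f' x) x) (γ : C(K, E)) :
    HasFDerivAt (fun γ : C(K, E) => f.comp γ) (pointwiseApply K E F (f'.comp γ)) γ := by
  rw [hasFDerivAt_iff_isLittleO_nhds_zero, Asymptotics.isLittleO_iff]
  intro c hc
  have hrange : IsCompact (range γ) := isCompact_range γ.continuous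
  obtain ⟨δ, hδ, hunif⟩ := Metric.mem_uniformity_dist.1
    (hrange.uniformContinuousAt_of_continuousAt f' (fun _ _ => f'.continuous.continuousAt)
      (Metric.dist_mem_uniformity hc))
  filter_upwards [Metric.ball_mem_nhds (0 : C(K, E)) hδ] with h hh
  rw [ContinuousMap.norm_le _ (by positivity)]
  intro t
  have hht : ‖h t‖ < δ := (h.norm_coe_le_norm t).trans_lt (by simpa using hh)
  have hf' : ∀ x ∈ Metric.ball (γ t) δ, ‖f' x - f' (γ t)‖ ≤ c := fun x hx => by
    rw [← dist_eq_norm, dist_comm]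
    exact (hunif (by rwa [dist_comm]) (mem_range_self t)).le
  have hmean : ‖f (γ t + h t) - f (γ t) - f' (γ t) (h t)‖ ≤ c * ‖h t‖ := by
    simpa only [add_sub_cancel_left] using
      (convex_ball (γ t) δ).norm_image_sub_le_of_norm_hasFDerivWithin_le'
        (fun x _ => (hf x).hasFDerivWithinAt) hf' (Metric.mem_ball_self hδ)
        (y := γ t + h t) (by simpa [dist_eq_norm] using hht)
  calc ‖(f.comp (γ + h) - f.comp γ - pointwiseApply K E F (f'.comp γ) h) t‖
      = ‖f (γ t + h t) - f (γ t) - f' (γ t) (h t)‖ := by simp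
    _ ≤ c * ‖h t‖ := hmean
    _ ≤ c * ‖h‖ := by gcongr; exact h.norm_coe_le_norm t

variable {E : Type u} [NormedAddCommGroup E] [NormedSpace ℝ E]

theorem contDiff_superposition_nat (n : ℕ) :
    ∀ {F : Type u} [NormedAddCommGroup F] [NormedSpace ℝ F] (f : C(E, F)), ContDiff ℝ n f →
      ContDiff ℝ n (fun γ : C(K, E) => f.comp γ) := by
  induction n with
  | zero =>
    intro F _ _ f _
    simpa only [Nat.cast_zero, contDiff_zero] using f.continuous_postcomp
  | succ n ih =>
    intro F _ _ f hf
    obtain ⟨f', hf', hderiv⟩ := contDiff_succ_iff_hasFDerivAt.1 (by exact_mod_cast hf)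
    let f'C : C(E, E →L[ℝ] F) := ⟨f', hf'.continuous⟩
    push_cast
    refine contDiff_succ_iff_hasFDerivAt.2 ⟨fun γ => pointwiseApply K E F (f'C.comp γ), ?_,
      fun γ => hasFDerivAt_superposition (f' := f'C) hderiv γ⟩
    exact (pointwiseApply K E F).contDiff.comp (ih f'C hf')

theorem contDiff_superposition {F : Type u} [NormedAddCommGroup F] [NormedSpace ℝ F]
    (f : C(E, F)) (hf : ContDiff ℝ ∞ f) : ContDiff ℝ ∞ (fun γ : C(K, E) => f.comp γ) :=
  contDiff_infty.2 fun n => contDiff_superposition_nat n f (contDiff_infty.1 hf n)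

end Superposition

/-! ### Local actions generated by commuting vector fields -/

section LocalAction

open unitInterval

section Primitive

variable {Y : Type*} [NormedAddCommGroup Y] [NormedSpace ℝ Y]

/-- The primitive `t ↦ ∫₀ᵗ f` of a continuous curve on the unit interval; outside the interval the
integrand is continued by constants. -/
def primitive : C(I, Y) →L[ℝ] C(I, Y) :=
  LinearMap.mkContinuous
    { toFun := fun f => ⟨fun t => ∫ s in (0 : ℝ)..t, IccExtend zero_le_one f s,
        (intervalIntegral.continuous_primitive
          (fun _ _ => f.continuous.Icc_extend'.intervalIntegrable _ _) 0).comp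
          continuous_subtype_val⟩
      map_add' := fun f g => by
        ext t
        exact intervalIntegral.integral_add (f.continuous.Icc_extend'.intervalIntegrable _ _)
          (g.continuous.Icc_extend'.intervalIntegrable _ _)
      map_smul' := fun c f => by
        ext t
        exact intervalIntegral.integral_smul c _ } 1
    (fun f => by
      rw [ContinuousMap.norm_le _ (by positivity), one_mul]
      intro t
      refine (intervalIntegral.norm_integral_le_of_norm_le_const
        (C := ‖f‖) fun s _ => f.norm_coe_le_norm _).trans ?_
      refine mul_le_of_le_one_right (norm_nonneg _) ?_
      rw [sub_zero, abs_of_nonneg t.2.1]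
      exact t.2.2)

theorem hasDerivWithinAt_IccExtend [CompleteSpace Y] {γ f : C(I, Y)} {y : Y}
    (hγ : γ = ContinuousLinearMap.const ℝ I y + primitive f) (t : I) :
    HasDerivWithinAt (IccExtend zero_le_one γ) (f t) I t := by
  have hint : HasDerivAt (fun t => y + ∫ s in (0 : ℝ)..t, IccExtend zero_le_one f s)
      (IccExtend zero_le_one f t) t :=
    (f.continuous.Icc_extend'.integral_hasStrictDerivAt 0 t).hasDerivAt.const_add y
  rw [IccExtend_val] at hint
  refine hint.hasDerivWithinAt.congr (fun s hs => ?_) ?_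
  · rw [IccExtend_of_mem _ _ hs, hγ]
    rfl
  · rw [IccExtend_val, hγ]
    rfl

end Primitive

variable {P Z : Type u} [NormedAddCommGroup P] [NormedSpace ℝ P]
  [NormedAddCommGroup Z] [NormedSpace ℝ Z]

/-- A linear family `p ↦ V · p` of vector fields on `Z`, parametrized by `P`, whose members commute
on a neighbourhood of `z₀`. -/
def CommuteNear (V : Z → P →L[ℝ] Z) (z₀ : Z) : Prop :=
  ∀ᶠ z in 𝓝 z₀, ∀ p q, fderiv ℝ V z (V z p) q = fderiv ℝ V z (V z q) p

/-- Gronwall's inequality applied to `δ t - t • V (γ t) q`, which satisfies the homogeneous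
linearized equation because the fields commute. -/
theorem linearized_flow_eq {V : Z → P →L[ℝ] Z} (hV : ContDiff ℝ ∞ V) {p q : P} {γ δ : ℝ → Z}
    (hγ : ∀ t ∈ I, HasDerivWithinAt γ (V (γ t) p) I t) (hδ₀ : δ 0 = 0)
    (hδ : ∀ t ∈ I, HasDerivWithinAt δ (V (γ t) q + fderiv ℝ V (γ t) (δ t) p) I t)
    (hcomm : ∀ t ∈ I, fderiv ℝ V (γ t) (V (γ t) p) q = fderiv ℝ V (γ t) (V (γ t) q) p) :
    δ 1 = V (γ 1) q := by
  let W : ℝ → Z := fun t => δ t - t • V (γ t) q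
  have hW : ∀ t ∈ I, HasDerivWithinAt W (fderiv ℝ V (γ t) (W t) p) I t := by
    intro t ht
    have hVγ : HasDerivWithinAt (fun t => V (γ t) q) (fderiv ℝ V (γ t) (V (γ t) p) q) I t := by
      have hV' := (hV.differentiable (by simp) (γ t)).hasFDerivAt.comp_hasDerivWithinAt t (hγ t ht)
      simpa using hV'.clm_apply (hasDerivWithinAt_const t I q)
    refine ((hδ t ht).sub ((hasDerivWithinAt_id t I).smul hVγ)).congr_deriv ?_
    simp only [id, one_smul, hcomm t ht, W, map_sub, map_smul, sub_apply, smul_apply]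
    abel
  have hcont : ContinuousOn (fun t => ‖fderiv ℝ V (γ t)‖) I :=
    (hV.continuous_fderiv (by simp)).norm.comp_continuousOn
      fun t ht => (hγ t ht).continuousWithinAt
  obtain ⟨C, hC⟩ := isCompact_Icc.bddAbove_image hcont
  have hW₁ : W 1 = 0 := by
    refine eq_zero_of_abs_deriv_le_mul_abs_self_of_eq_zero_right (K := C * ‖p‖)
      (fun t ht => (hW t ht).continuousWithinAt)
      (fun t ht => (hW t (Ico_subset_Icc_self ht)).mono_of_mem_nhdsWithin
        (Icc_mem_nhdsGE_of_mem ht)) (by simp [W, hδ₀]) (fun t ht => ?_) 1 (by simp)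
    calc ‖fderiv ℝ V (γ t) (W t) p‖
        ≤ ‖fderiv ℝ V (γ t)‖ * ‖W t‖ * ‖p‖ := (fderiv ℝ V (γ t)).le_opNorm₂ (W t) p
      _ ≤ C * ‖W t‖ * ‖p‖ := by gcongr; exact hC (mem_image_of_mem _ (Ico_subset_Icc_self ht))
      _ = C * ‖p‖ * ‖W t‖ := by ring
  simpa [W, sub_eq_zero] using hW₁

/-- The right-hand side `t ↦ z + ∫₀ᵗ V (γ s) p ds` of the integral equation for the curve through
`z` that follows the field `V · p`, as a function of `((p, z), γ)`. -/
def flowIntegral (V : C(Z, P →L[ℝ] Z)) (w : (P × Z) × C(I, Z)) : C(I, Z) :=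
  ContinuousLinearMap.const ℝ I w.1.2 +
    primitive (pointwiseApply I P Z (V.comp w.2) (ContinuousLinearMap.const ℝ I w.1.1))

theorem flowIntegral_zero (V : C(Z, P →L[ℝ] Z)) (z : Z) (γ : C(I, Z)) :
    flowIntegral V ((0, z), γ) = ContinuousLinearMap.const ℝ I z := by
  simp [flowIntegral]

theorem contDiff_flowIntegral {V : C(Z, P →L[ℝ] Z)} (hV : ContDiff ℝ ∞ V) :
    ContDiff ℝ ∞ (flowIntegral V) := by
  have hVγ : ContDiff ℝ ∞ fun w : (P × Z) × C(I, Z) => V.comp w.2 :=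
    (contDiff_superposition V hV).comp contDiff_snd
  exact ((ContinuousLinearMap.const ℝ I).contDiff.comp contDiff_fst.snd).add
    (primitive.contDiff.comp
      (((pointwiseApply I P Z).contDiff.comp hVγ).clm_apply
        ((ContinuousLinearMap.const ℝ I).contDiff.comp contDiff_fst.fst)))

theorem fderiv_flowIntegral_apply {V : C(Z, P →L[ℝ] Z)} {V' : C(Z, Z →L[ℝ] P →L[ℝ] Z)}
    (hV : ∀ z, HasFDerivAt V (V' z) z) (w h : (P × Z) × C(I, Z)) :
    fderiv ℝ (flowIntegral V) w h = ContinuousLinearMap.const ℝ I h.1.2 +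
      primitive (pointwiseApply I P Z (V.comp w.2) (ContinuousLinearMap.const ℝ I h.1.1) +
        pointwiseApply I P Z (pointwiseApply I Z (P →L[ℝ] Z) (V'.comp w.2) h.2)
          (ContinuousLinearMap.const ℝ I w.1.1)) := by
  have hVγ := (hasFDerivAt_superposition hV w.2).comp w
    (hasFDerivAt_snd (𝕜 := ℝ) (E := P × Z) (F := C(I, Z)))
  have hp := (ContinuousLinearMap.const ℝ I).hasFDerivAt.comp w
    (hasFDerivAt_fst.comp w (hasFDerivAt_fst (𝕜 := ℝ) (E := P × Z) (F := C(I, Z))))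
  have hz := (ContinuousLinearMap.const ℝ I).hasFDerivAt.comp w
    (hasFDerivAt_snd.comp w (hasFDerivAt_fst (𝕜 := ℝ) (E := P × Z) (F := C(I, Z))))
  have hVp := (pointwiseApply I P Z).hasFDerivAt_of_bilinear hVγ hp
  exact congrArg (· h) (hz.add (primitive.hasFDerivAt.comp w hVp)).fderiv

variable [CompleteSpace Z]

theorem exists_flow_curves [CompleteSpace P] {V : C(Z, P →L[ℝ] Z)} (hV : ContDiff ℝ ∞ V) (z₀ : Z) :
    ∃ γ : P × Z → C(I, Z), SmoothNear γ (0, z₀) ∧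
      γ (0, z₀) = ContinuousLinearMap.const ℝ I z₀ ∧
      ∀ᶠ w in 𝓝 (0, z₀), γ w = flowIntegral V (w, γ w) := by
  let N : (P × Z) × C(I, Z) → C(I, Z) := fun w => w.2 - flowIntegral V w
  let V' : C(Z, Z →L[ℝ] P →L[ℝ] Z) := ⟨fderiv ℝ V, hV.continuous_fderiv (by simp)⟩
  have hN : ContDiff ℝ ∞ N := contDiff_snd.sub (contDiff_flowIntegral hV)
  have hpartial : ∀ h, fderiv ℝ N ((0, z₀), ContinuousLinearMap.const ℝ I z₀) (0, h)
      = ContinuousLinearEquiv.refl ℝ C(I, Z) h := by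
    intro h
    have hderiv : HasFDerivAt N _ ((0, z₀), ContinuousLinearMap.const ℝ I z₀) :=
      hasFDerivAt_snd.sub ((contDiff_flowIntegral hV).differentiable (by simp) _).hasFDerivAt
    rw [hderiv.fderiv, sub_apply,
      fderiv_flowIntegral_apply (V' := V') fun z => (hV.differentiable (by simp) z).hasFDerivAt]
    simp
  obtain ⟨γ, hγ, hγ₀, hsol⟩ := (smoothNear_of_contDiff hN _).exists_implicit
    (by simp [N, flowIntegral_zero]) (ContinuousLinearEquiv.refl ℝ C(I, Z)) hpartial
  exact ⟨γ, hγ, hγ₀, hsol.mono fun _ hw => sub_eq_zero.1 hw⟩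

theorem fderiv_flow_curves_apply_one {V : C(Z, P →L[ℝ] Z)} (hV : ContDiff ℝ ∞ V)
    {γ : P × Z → C(I, Z)} {w : P × Z} (hγ : DifferentiableAt ℝ γ w)
    (hsol : ∀ᶠ w' in 𝓝 w, γ w' = flowIntegral V (w', γ w'))
    (hcomm : ∀ t p q, fderiv ℝ V (γ w t) (V (γ w t) p) q = fderiv ℝ V (γ w t) (V (γ w t) q) p)
    (q : P) : fderiv ℝ γ w (q, 0) 1 = V (γ w 1) q := by
  let V' : C(Z, Z →L[ℝ] P →L[ℝ] Z) := ⟨fderiv ℝ V, hV.continuous_fderiv (by simp)⟩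
  have hV' : ∀ z, HasFDerivAt V (V' z) z := fun z => (hV.differentiable (by simp) z).hasFDerivAt
  let δ : C(I, Z) := fderiv ℝ γ w (q, 0)
  have hlinearized : δ = ContinuousLinearMap.const ℝ I 0 +
      primitive (pointwiseApply I P Z (V.comp (γ w)) (ContinuousLinearMap.const ℝ I q) +
        pointwiseApply I P Z (pointwiseApply I Z (P →L[ℝ] Z) (V'.comp (γ w)) δ)
          (ContinuousLinearMap.const ℝ I w.1)) := by
    have hint : HasFDerivAt (fun w' => flowIntegral V (w', γ w')) _ w :=
      HasFDerivAt.comp (f := fun w' => (w', γ w')) w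
        ((contDiff_flowIntegral hV).differentiable (by simp) (w, γ w)).hasFDerivAt
        ((hasFDerivAt_id w).prodMk hγ.hasFDerivAt)
    calc δ = fderiv ℝ (flowIntegral V) (w, γ w) ((q, 0), δ) :=
          congrArg (· (q, 0)) (hγ.hasFDerivAt.unique (hint.congr_of_eventuallyEq hsol))
      _ = _ := fderiv_flowIntegral_apply hV' (w, γ w) ((q, 0), δ)
  have hmain := linearized_flow_eq hV (p := w.1) (q := q) (γ := IccExtend zero_le_one (γ w))
    (δ := IccExtend zero_le_one δ)
    (fun t ht => by
      simpa [IccExtend_of_mem _ _ ht] using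
        hasDerivWithinAt_IccExtend hsol.self_of_nhds ⟨t, ht⟩)
    (by
      rw [IccExtend_left, hlinearized]
      simp [primitive])
    (fun t ht => by
      simpa [IccExtend_of_mem _ _ ht, V'] using hasDerivWithinAt_IccExtend hlinearized ⟨t, ht⟩)
    (fun t _ => hcomm _ _ _)
  simpa using hmain

/-- The fields are integrated by following `V · p` for unit time; commutativity makes the time-one
map depend on `p` as a joint integral of all the fields. -/
theorem exists_local_action_of_contDiff [CompleteSpace P] {V : Z → P →L[ℝ] Z}
    (hV : ContDiff ℝ ∞ V) {z₀ : Z} (hcomm : CommuteNear V z₀) :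
    ∃ Ψ : P × Z → Z, SmoothNear Ψ (0, z₀) ∧ (∀ᶠ z in 𝓝 z₀, Ψ (0, z) = z) ∧
      ∀ᶠ w in 𝓝 (0, z₀), ∀ p, fderiv ℝ Ψ w (p, 0) = V (Ψ w) p := by
  obtain ⟨γ, hγ, hγ₀, hsol⟩ := exists_flow_curves (V := ⟨V, hV.continuous⟩) hV z₀
  let ev : C(I, Z) →L[ℝ] Z := ContinuousMap.evalCLM ℝ (1 : I)
  refine ⟨fun w => γ w 1, (smoothNear_of_contDiff ev.contDiff _).comp hγ, ?_, ?_⟩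
  · filter_upwards [(Continuous.prodMk_right (0 : P)).continuousAt.eventually hsol] with z hz
    rw [hz, flowIntegral_zero]
    rfl
  · obtain ⟨r, hr, hball⟩ := Metric.eventually_nhds_iff_ball.1 hcomm
    have hclose : ∀ᶠ w in 𝓝 (0, z₀), γ w ∈ Metric.ball (γ (0, z₀)) r :=
      hγ.continuousAt.eventually (Metric.ball_mem_nhds _ hr)
    filter_upwards [hclose, hγ.eventually_differentiableAt, eventually_eventually_nhds.2 hsol]
      with w hw hdiff hsolw p
    have hmem : ∀ t, γ w t ∈ Metric.ball z₀ r := fun t => by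
      simpa [hγ₀] using (ContinuousMap.dist_apply_le_dist t).trans_lt (Metric.mem_ball.1 hw)
    have hev : fderiv ℝ (fun w => γ w 1) w = ev.comp (fderiv ℝ γ w) :=
      (ev.hasFDerivAt.comp w hdiff.hasFDerivAt).fderiv
    rw [hev]
    exact fderiv_flow_curves_apply_one hV hdiff hsolw (fun t => hball _ (hmem t)) p

end LocalAction

theorem exists_local_action {P Z : Type u} [NormedAddCommGroup P] [NormedSpace ℝ P]
    [CompleteSpace P] [NormedAddCommGroup Z] [NormedSpace ℝ Z] [FiniteDimensional ℝ Z]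
    {V : Z → P →L[ℝ] Z} {z₀ : Z} (hV : SmoothNear V z₀) (hcomm : CommuteNear V z₀) :
    ∃ Ψ : P × Z → Z, SmoothNear Ψ (0, z₀) ∧ (∀ᶠ z in 𝓝 z₀, Ψ (0, z) = z) ∧
      ∀ᶠ w in 𝓝 (0, z₀), ∀ p, fderiv ℝ Ψ w (p, 0) = V (Ψ w) p := by
  have := FiniteDimensional.complete ℝ Z
  obtain ⟨U, hU, hUV⟩ := hV.exists_contDiff_eventuallyEq
  have hcommU : CommuteNear U z₀ := by
    filter_upwards [hcomm, eventually_eventually_nhds.2 hUV] with z hz hUz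
    rw [EventuallyEq.fderiv_eq hUz, hUz.self_of_nhds]
    exact hz
  obtain ⟨Ψ, hΨ, hΨ₀, hderiv⟩ := exists_local_action_of_contDiff hU hcommU
  have hΨcont : Tendsto Ψ (𝓝 (0, z₀)) (𝓝 z₀) := by
    simpa only [hΨ₀.self_of_nhds] using hΨ.continuousAt.tendsto
  refine ⟨Ψ, hΨ, hΨ₀, ?_⟩
  filter_upwards [hderiv, hΨcont.eventually hUV] with w hw hUw p
  rw [hw p, hUw]

/-! ### One-forms that are closed along the leaves of a hyperplane distribution -/

section Leaves

section

variable {E F G : Type*} [NormedAddCommGroup E] [NormedSpace ℝ E]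
  [NormedAddCommGroup F] [NormedSpace ℝ F] [NormedAddCommGroup G] [NormedSpace ℝ G]

theorem fderiv_clm_apply_const {A : E → F →L[ℝ] G} {x : E} (hA : DifferentiableAt ℝ A x) (c : F)
    (v : E) : fderiv ℝ (fun z => A z c) x v = fderiv ℝ A x v c := by
  simp [(hA.hasFDerivAt.clm_apply (hasFDerivAt_const c x)).fderiv]

theorem fderiv_symm_comp_apply {g : E → G} {Θ : OpenPartialHomeomorph E F} {y : E}
    (hy : y ∈ Θ.source) (hΘ : DifferentiableAt ℝ Θ y) (hsymm : DifferentiableAt ℝ Θ.symm (Θ y))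
    (hg : DifferentiableAt ℝ g y) (h : E) :
    fderiv ℝ (fun x => g (Θ.symm x)) (Θ y) (fderiv ℝ Θ y h) = fderiv ℝ g y h := by
  have hcomp : DifferentiableAt ℝ (fun x => g (Θ.symm x)) (Θ y) :=
    DifferentiableAt.comp (Θ y) (by rwa [Θ.left_inv hy]) hsymm
  have hleft : (fun x => g (Θ.symm (Θ x))) =ᶠ[𝓝 y] g := by
    filter_upwards [Θ.open_source.mem_nhds hy] with x hx
    rw [Θ.left_inv hx]
  rw [← hleft.fderiv_eq]
  exact congrArg (· h) (fderiv_comp y hcomp hΘ).symm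

theorem exists_apply_ne_zero {κ : E →L[ℝ] ℝ} (hκ : κ ≠ 0) : ∃ e, κ e ≠ 0 := by
  by_contra! h
  exact hκ (ContinuousLinearMap.ext h)

end

variable {E : Type u} [NormedAddCommGroup E] [NormedSpace ℝ E]

/-- The value `(dκ)ₓ(v, w)` of the exterior derivative of a one-form `κ` on a vector space. -/
def extD (κ : E → E →L[ℝ] ℝ) (x v w : E) : ℝ := fderiv ℝ κ x v w - fderiv ℝ κ x w v

/-- The value `(α ∧ β)(v, w)` of the wedge product of two linear forms. -/
def wedge (α β : E →L[ℝ] ℝ) (v w : E) : ℝ := α v * β w - α w * β v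

theorem fderiv_smul_form {f : E → ℝ} {κ : E → E →L[ℝ] ℝ} {x : E} (hf : DifferentiableAt ℝ f x)
    (hκ : DifferentiableAt ℝ κ x) (v w : E) :
    fderiv ℝ (fun z => f z • κ z) x v w = fderiv ℝ f x v * κ x w + f x * fderiv ℝ κ x v w := by
  rw [show (fun z => f z • κ z) = f • κ from rfl, (hf.hasFDerivAt.smul hκ.hasFDerivAt).fderiv]
  simp only [add_apply, smul_apply, ContinuousLinearMap.smulRight_apply, smul_eq_mul]
  ring

theorem extD_smul {f : E → ℝ} {κ : E → E →L[ℝ] ℝ} {x : E} (hf : DifferentiableAt ℝ f x)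
    (hκ : DifferentiableAt ℝ κ x) (v w : E) :
    extD (fun z => f z • κ z) x v w = wedge (fderiv ℝ f x) (κ x) v w + f x * extD κ x v w := by
  simp only [extD, wedge, fderiv_smul_form hf hκ]
  ring

theorem extD_add {κ μ : E → E →L[ℝ] ℝ} {x : E} (hκ : DifferentiableAt ℝ κ x)
    (hμ : DifferentiableAt ℝ μ x) (v w : E) :
    extD (fun z => κ z + μ z) x v w = extD κ x v w + extD μ x v w := by
  simp only [extD, fderiv_fun_add hκ hμ, add_apply]
  ring

theorem extD_sub {κ μ : E → E →L[ℝ] ℝ} {x : E} (hκ : DifferentiableAt ℝ κ x)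
    (hμ : DifferentiableAt ℝ μ x) (v w : E) :
    extD (fun z => κ z - μ z) x v w = extD κ x v w - extD μ x v w := by
  simp only [extD, fderiv_fun_sub hκ hμ, sub_apply]
  ring

theorem extD_congr {κ μ : E → E →L[ℝ] ℝ} {x : E} (h : κ =ᶠ[𝓝 x] μ) (v w : E) :
    extD κ x v w = extD μ x v w := by
  simp only [extD, h.fderiv_eq]

theorem extD_fderiv {f : E → ℝ} {x : E} (hf : ContDiffAt ℝ ∞ f x) (v w : E) :
    extD (fderiv ℝ f) x v w = 0 :=
  sub_eq_zero.2 ((hf.isSymmSndFDerivAt (by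
    simpa using (ENat.LEInfty.out : (2 : WithTop ℕ∞) ≤ ∞))).eq v w)

/-- For each `ξ`, the vector field `(ξ - ν(ξ) e, ρ(ξ))` on `E × ℝ`. When `ν(e) = 1` its first
component is tangent to `ker ν`, so that its orbits are graphs over the leaves of `ker ν` of
functions with differential `ρ`. -/
def leafField (ν ρ : E → E →L[ℝ] ℝ) (e : E) (z : E × ℝ) : E →L[ℝ] E × ℝ :=
  (ContinuousLinearMap.id ℝ E - (ν z.1).smulRight e).prod (ρ z.1)

theorem leafField_apply (ν ρ : E → E →L[ℝ] ℝ) (e : E) (z : E × ℝ) (ξ : E) :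
    leafField ν ρ e z ξ = (ξ - ν z.1 ξ • e, ρ z.1 ξ) := rfl

theorem smoothNear_leafField {ν ρ : E → E →L[ℝ] ℝ} {p e : E} (hν : SmoothNear ν p)
    (hρ : SmoothNear ρ p) (r : ℝ) : SmoothNear (leafField ν ρ e) (p, r) := by
  filter_upwards [continuous_fst.continuousAt.eventually hν,
    continuous_fst.continuousAt.eventually hρ] with z hνz hρz
  have hcomp := (contDiffAt_const (c := ContinuousLinearMap.id ℝ E)).sub
    ((hνz.comp z contDiffAt_fst).smulRight (contDiffAt_const (c := e)))
  exact (ContinuousLinearMap.prodₗᵢ ℝ).toContinuousLinearEquiv.contDiff.contDiffAt.comp z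
    (hcomp.prodMk (hρz.comp z contDiffAt_fst))

theorem fderiv_leafField_apply {ν ρ : E → E →L[ℝ] ℝ} {e : E} {z : E × ℝ}
    (hV : DifferentiableAt ℝ (leafField ν ρ e) z) (hν : DifferentiableAt ℝ ν z.1)
    (hρ : DifferentiableAt ℝ ρ z.1) (v : E × ℝ) (ξ : E) :
    fderiv ℝ (leafField ν ρ e) z v ξ =
      (-(fderiv ℝ ν z.1 v.1 ξ • e), fderiv ℝ ρ z.1 v.1 ξ) := by
  have hνξ := (hν.hasFDerivAt.clm_apply (hasFDerivAt_const ξ z.1)).comp z hasFDerivAt_fst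
  have hρξ := (hρ.hasFDerivAt.clm_apply (hasFDerivAt_const ξ z.1)).comp z hasFDerivAt_fst
  have hfield : HasFDerivAt (fun z => leafField ν ρ e z ξ) _ z :=
    ((hasFDerivAt_const ξ z).sub (hνξ.smul_const e)).prodMk hρξ
  rw [← fderiv_clm_apply_const hV, hfield.fderiv]
  simp

theorem apply_sub_smul_comm {ν : E →L[ℝ] ℝ} {D : E →L[ℝ] E →L[ℝ] ℝ} {e : E}
    (hν : ν e = 1) (hD : ∀ v, D v e = 0) (hsymm : ∀ v w, ν v = 0 → ν w = 0 → D v w = D w v)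
    (ξ η : E) : D (ξ - ν ξ • e) η = D (η - ν η • e) ξ := by
  have hproj : ∀ v w, D v (w - ν w • e) = D v w := by simp [hD]
  rw [← hproj, ← hproj _ ξ]
  exact hsymm _ _ (by simp [hν]) (by simp [hν])

theorem commuteNear_leafField {ν ρ : E → E →L[ℝ] ℝ} {p e : E} (hν : SmoothNear ν p)
    (hρ : SmoothNear ρ p) (hνe : ∀ᶠ x in 𝓝 p, ν x e = 1) (hρe : ∀ᶠ x in 𝓝 p, ρ x e = 0)
    (hdν : ∀ᶠ x in 𝓝 p, ∀ v w, ν x v = 0 → ν x w = 0 → extD ν x v w = 0)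
    (hdρ : ∀ᶠ x in 𝓝 p, ∀ v w, ν x v = 0 → ν x w = 0 → extD ρ x v w = 0) (r : ℝ) :
    CommuteNear (leafField ν ρ e) (p, r) := by
  have hconst {σ : E → E →L[ℝ] ℝ} {c : ℝ} (hσ : SmoothNear σ p) (hσe : ∀ᶠ x in 𝓝 p, σ x e = c) :
      ∀ᶠ x in 𝓝 p, ∀ v, fderiv ℝ σ x v e = 0 := by
    filter_upwards [hσ.eventually_differentiableAt, eventually_eventually_nhds.2 hσe]
      with x hx hxe v
    rw [← fderiv_clm_apply_const hx, EventuallyEq.fderiv_eq hxe]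
    simp
  have hfst : Tendsto Prod.fst (𝓝 (p, r)) (𝓝 p) := continuous_fst.continuousAt
  filter_upwards [(smoothNear_leafField hν hρ r).eventually_differentiableAt,
    hfst.eventually hν.eventually_differentiableAt, hfst.eventually hρ.eventually_differentiableAt,
    hfst.eventually hνe, hfst.eventually (hconst hν hνe), hfst.eventually (hconst hρ hρe),
    hfst.eventually hdν, hfst.eventually hdρ] with z hVz hνz hρz hνez hDν hDρ hdνz hdρz ξ η
  rw [fderiv_leafField_apply hVz hνz hρz, fderiv_leafField_apply hVz hνz hρz, leafField_apply,
    leafField_apply, apply_sub_smul_comm hνez hDν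
      fun v w hv hw => sub_eq_zero.1 (hdνz v w hv hw),
    apply_sub_smul_comm hνez hDρ fun v w hv hw => sub_eq_zero.1 (hdρz v w hv hw)]

theorem leafField_apply_sub_smul {ν ρ : E → E →L[ℝ] ℝ} {e w : E} {z : E × ℝ}
    (hνe : ν z.1 e = 1) (hρe : ρ z.1 e = 0) (hw : ν z.1 w = 0) (c : ℝ) :
    leafField ν ρ e z (w - c • e) = (w, ρ z.1 w) := by
  simp [leafField_apply, hνe, hρe, hw]

theorem exists_leaf_chart [FiniteDimensional ℝ E] {ν ρ : E → E →L[ℝ] ℝ} {p e : E}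
    (hν : SmoothNear ν p) (hρ : SmoothNear ρ p) (hνe : ∀ᶠ x in 𝓝 p, ν x e = 1)
    (hρe : ∀ᶠ x in 𝓝 p, ρ x e = 0)
    (hdν : ∀ᶠ x in 𝓝 p, ∀ v w, ν x v = 0 → ν x w = 0 → extD ν x v w = 0)
    (hdρ : ∀ᶠ x in 𝓝 p, ∀ v w, ν x v = 0 → ν x w = 0 → extD ρ x v w = 0) :
    ∃ Φ : E → E × ℝ, SmoothNear Φ 0 ∧ Φ 0 = (p, 0) ∧
      HasFDerivAt (fun y => (Φ y).1) (ContinuousLinearMap.id ℝ E) 0 ∧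
      ∀ᶠ y in 𝓝 0, ∀ ξ, ν p ξ = 0 → fderiv ℝ Φ y ξ = leafField ν ρ e (Φ y) ξ := by
  have := FiniteDimensional.complete ℝ E
  obtain ⟨Ψ, hΨ, hΨ₀, hflow⟩ := exists_local_action (smoothNear_leafField (e := e) hν hρ 0)
    (commuteNear_leafField hν hρ hνe hρe hdν hdρ 0)
  let i : E → E × (E × ℝ) := fun y => (y, (p + ν p y • e, 0))
  have hi₀ : i 0 = (0, (p, 0)) := by simp [i]
  have hi (y : E) :
      HasFDerivAt i ((ContinuousLinearMap.id ℝ E).prod (((ν p).smulRight e).prod 0)) y :=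
    (hasFDerivAt_id y).prodMk
      ((((ν p).hasFDerivAt.smul_const e).const_add p).prodMk (hasFDerivAt_const 0 y))
  have hi_smooth : SmoothNear i 0 := smoothNear_of_contDiff (by fun_prop) 0
  have hi_tendsto : Tendsto i (𝓝 0) (𝓝 (0, (p, 0))) := hi₀ ▸ (hi 0).continuousAt.tendsto
  have hcomp {y : E} (hy : DifferentiableAt ℝ Ψ (i y)) :
      HasFDerivAt (fun y => Ψ (i y)) _ y := hy.hasFDerivAt.comp y (hi y)
  refine ⟨fun y => Ψ (i y), SmoothNear.comp (hi₀ ▸ hΨ) hi_smooth, ?_, ?_, ?_⟩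
  · simpa [hi₀] using hΨ₀.self_of_nhds
  · have hinit : fderiv ℝ Ψ (0, (p, 0)) ∘L ContinuousLinearMap.inr ℝ E (E × ℝ) =
        ContinuousLinearMap.id ℝ (E × ℝ) :=
      (hΨ.differentiableAt.hasFDerivAt.comp (p, (0 : ℝ)) (hasFDerivAt_prodMk_right 0 (p, 0))).unique
        ((hasFDerivAt_id _).congr_of_eventuallyEq hΨ₀)
    refine (hasFDerivAt_fst.comp 0 (hcomp (hi₀ ▸ hΨ.differentiableAt))).congr_fderiv ?_
    ext ξ
    have hsplit : ((ξ, (ν p ξ • e, 0)) : E × (E × ℝ)) = (ξ, 0) + (0, (ν p ξ • e, 0)) := by simp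
    have hΨξ := congrArg (· (ν p ξ • e, (0 : ℝ))) hinit
    simp only [ContinuousLinearMap.comp_apply, ContinuousLinearMap.inr_apply,
      ContinuousLinearMap.id_apply] at hΨξ
    simp only [ContinuousLinearMap.comp_apply, ContinuousLinearMap.prod_apply,
      ContinuousLinearMap.id_apply, ContinuousLinearMap.smulRight_apply, zero_apply, hi₀]
    rw [hsplit, map_add, hflow.self_of_nhds, hΨ₀.self_of_nhds, hΨξ, leafField_apply]
    simp
  · filter_upwards [hi_tendsto.eventually hΨ.eventually_differentiableAt,
      hi_tendsto.eventually hflow] with y hy hflowy ξ hξ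
    rw [(hcomp hy).fderiv, ← hflowy]
    simp [hξ, Prod.zero_eq_mk]

theorem exists_leafwise_primitive_of_normalized [FiniteDimensional ℝ E] {ν ρ : E → E →L[ℝ] ℝ}
    {p e : E} (hν : SmoothNear ν p) (hρ : SmoothNear ρ p) (hνe : ∀ᶠ x in 𝓝 p, ν x e = 1)
    (hρe : ∀ᶠ x in 𝓝 p, ρ x e = 0)
    (hdν : ∀ᶠ x in 𝓝 p, ∀ v w, ν x v = 0 → ν x w = 0 → extD ν x v w = 0)
    (hdρ : ∀ᶠ x in 𝓝 p, ∀ v w, ν x v = 0 → ν x w = 0 → extD ρ x v w = 0) :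
    ∃ u G : E → ℝ, SmoothNear u p ∧ SmoothNear G p ∧ fderiv ℝ u p = ν p ∧
      ∀ᶠ x in 𝓝 p, ∀ w, ν x w = 0 → fderiv ℝ u x w = 0 ∧ fderiv ℝ G x w = ρ x w := by
  have := FiniteDimensional.complete ℝ E
  obtain ⟨Φ, hΦ, hΦ₀, hΦ', hleaf⟩ := exists_leaf_chart hν hρ hνe hρe hdν hdρ
  have hfst : SmoothNear (fun y => (Φ y).1) 0 :=
    (smoothNear_of_contDiff contDiff_fst (Φ 0)).comp hΦ
  obtain ⟨Θ, hΘ, h0, hsmooth, hsymm⟩ :=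
    hfst.exists_openPartialHomeomorph (.refl ℝ E) hΦ'
  have hΘ₀ : Θ 0 = p := by simp [hΘ, hΦ₀]
  have hsymm₀ : Θ.symm p = 0 := by rw [← hΘ₀, Θ.left_inv h0]
  have hp : p ∈ Θ.target := hΘ₀ ▸ Θ.map_source h0
  have hinv : SmoothNear Θ.symm p := by
    filter_upwards [Θ.open_target.mem_nhds hp] with y hy using hsymm y hy
  have hinv_tendsto : Tendsto Θ.symm (𝓝 p) (𝓝 0) := hsymm₀ ▸ hinv.continuousAt.tendsto
  have hpull {g : E → ℝ} {y : E} (hy : y ∈ Θ.source) (hg : DifferentiableAt ℝ g y) (ξ : E) :=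
    fderiv_symm_comp_apply hy (hΘ ▸ (hsmooth y hy).differentiableAt (by simp))
      ((hsymm _ (Θ.map_source hy)).differentiableAt (by simp)) hg ξ
  refine ⟨fun x => ν p (Θ.symm x), fun x => (Φ (Θ.symm x)).2,
    (smoothNear_of_contDiff (ν p).contDiff _).comp hinv,
    (smoothNear_of_contDiff contDiff_snd _).comp (SmoothNear.comp (hsymm₀ ▸ hΦ) hinv), ?_, ?_⟩
  · ext ξ
    have hξ := hpull h0 (ν p).differentiableAt ξ
    rwa [hΘ₀, hΘ, hΦ'.fderiv, (ν p).fderiv] at hξ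
  · filter_upwards [Θ.open_target.mem_nhds hp, hνe, hρe, hinv_tendsto.eventually hleaf,
      hinv_tendsto.eventually hΦ.eventually_differentiableAt] with x hx hνx hρx hleafx hΦx w hw
    have hy := Θ.map_target hx
    have hΘy : (Φ (Θ.symm x)).1 = x := by simpa only [hΘ] using Θ.right_inv hx
    set y := Θ.symm x with hy_def
    have hνξ : ν p (w - ν p w • e) = 0 := by simp [hνe.self_of_nhds]
    have hDΦ : fderiv ℝ Φ y (w - ν p w • e) = (w, ρ x w) := by
      rw [hleafx _ hνξ, leafField_apply_sub_smul (by rwa [hΘy]) (by rwa [hΘy]) (by rwa [hΘy]), hΘy]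
    have hDΘ : fderiv ℝ Θ y (w - ν p w • e) = w := by
      rw [hΘ, hΦx.hasFDerivAt.fst.fderiv]
      exact congrArg Prod.fst hDΦ
    have hu := hpull hy (ν p).differentiableAt (w - ν p w • e)
    have hG := hpull hy (g := fun y => (Φ y).2) hΦx.snd (w - ν p w • e)
    rw [hDΘ, hy_def, Θ.right_inv hx] at hu hG
    refine ⟨by rw [hu, (ν p).fderiv, hνξ], ?_⟩
    rw [hG, ← hy_def, hΦx.hasFDerivAt.snd.fderiv]
    exact congrArg Prod.snd hDΦ

/-- The Frobenius theorem for the hyperplane distribution `ker κ`, together with the Poincaré lemma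
along its leaves. -/
theorem exists_leafwise_primitive [FiniteDimensional ℝ E] {κ μ : E → E →L[ℝ] ℝ} {p : E}
    (hκ : SmoothNear κ p) (hμ : SmoothNear μ p) (hκp : κ p ≠ 0)
    (hdκ : ∀ᶠ x in 𝓝 p, ∀ v w, κ x v = 0 → κ x w = 0 → extD κ x v w = 0)
    (hdμ : ∀ᶠ x in 𝓝 p, ∀ v w, κ x v = 0 → κ x w = 0 → extD μ x v w = 0) :
    ∃ u G : E → ℝ, SmoothNear u p ∧ SmoothNear G p ∧ fderiv ℝ u p = κ p ∧
      ∀ᶠ x in 𝓝 p, ∀ w, κ x w = 0 → fderiv ℝ u x w = 0 ∧ fderiv ℝ G x w = μ x w := by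
  obtain ⟨e, he⟩ : ∃ e, κ p e = 1 := by
    obtain ⟨v, hv⟩ := exists_apply_ne_zero hκp
    exact ⟨(κ p v)⁻¹ • v, by simp [hv]⟩
  have hκe : SmoothNear (fun x => κ x e) p := hκ.clm_apply (smoothNear_const e p)
  have hμe : SmoothNear (fun x => μ x e) p := hμ.clm_apply (smoothNear_const e p)
  have hκe_ne : ∀ᶠ x in 𝓝 p, κ x e ≠ 0 := hκe.continuousAt.eventually_ne (by simp [he])
  have hκe_inv : SmoothNear (fun x => (κ x e)⁻¹) p := hκe.inv (by simp [he])
  let ν : E → E →L[ℝ] ℝ := fun x => (κ x e)⁻¹ • κ x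
  have hν : SmoothNear ν p := hκe_inv.smul hκ
  have hνe : ∀ᶠ x in 𝓝 p, ν x e = 1 := hκe_ne.mono fun x hx => by simp [ν, hx]
  have hker : ∀ᶠ x in 𝓝 p, ∀ w, ν x w = 0 ↔ κ x w = 0 :=
    hκe_ne.mono fun x hx w => by simp [ν, hx]
  have hdν : ∀ᶠ x in 𝓝 p, ∀ v w, ν x v = 0 → ν x w = 0 → extD ν x v w = 0 := by
    filter_upwards [hdκ, hker, hκ.eventually_differentiableAt, hκe_inv.eventually_differentiableAt]
      with x hdκx hkerx hκx hκex v w hv hw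
    rw [hkerx] at hv hw
    rw [extD_smul hκex hκx, wedge, hv, hw, hdκx v w hv hw]
    ring
  have hdρ : ∀ᶠ x in 𝓝 p, ∀ v w, ν x v = 0 → ν x w = 0 →
      extD (fun x => μ x - μ x e • ν x) x v w = 0 := by
    filter_upwards [hdμ, hdν, hker, hμ.eventually_differentiableAt,
      hμe.eventually_differentiableAt, hν.eventually_differentiableAt]
      with x hdμx hdνx hkerx hμx hμex hνx v w hv hw
    rw [extD_sub hμx (hμex.fun_smul hνx), extD_smul hμex hνx, wedge, hdνx v w hv hw, hv, hw,
      hdμx v w ((hkerx v).1 hv) ((hkerx w).1 hw)]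
    ring
  obtain ⟨u, G, hu, hG, hup, hleaf⟩ := exists_leafwise_primitive_of_normalized hν
    (hμ.sub (hμe.smul hν)) hνe (hνe.mono fun x hx => by simp [hx]) hdν hdρ
  refine ⟨u, G, hu, hG, by rw [hup]; simp [ν, he], ?_⟩
  filter_upwards [hleaf, hker] with x hx hkerx w hw
  simpa [(hkerx w).2 hw] using hx w ((hkerx w).2 hw)

end Leaves

/-! ### Coordinates adapted to an integrable null coframe -/

section Coframe

variable {E : Type u} [NormedAddCommGroup E] [NormedSpace ℝ E]

theorem apply_eq_zero_of_wedge_eq_zero {σ κ : E →L[ℝ] ℝ} (hκ : κ ≠ 0)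
    (h : ∀ v w, wedge σ κ v w = 0) {a : E} (ha : κ a = 0) : σ a = 0 := by
  obtain ⟨e, he⟩ := exists_apply_ne_zero hκ
  simpa [wedge, ha, he] using h a e

theorem exists_smooth_factor {σ κ : E → E →L[ℝ] ℝ} {p : E} (hσ : SmoothNear σ p)
    (hκ : SmoothNear κ p) (hκp : κ p ≠ 0) (h : ∀ᶠ x in 𝓝 p, ∀ a, κ x a = 0 → σ x a = 0) :
    ∃ c : E → ℝ, SmoothNear c p ∧ ∀ᶠ x in 𝓝 p, σ x = c x • κ x := by
  obtain ⟨e, he⟩ := exists_apply_ne_zero hκp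
  have hκe : SmoothNear (fun z => κ z e) p := hκ.clm_apply (smoothNear_const e p)
  refine ⟨fun z => σ z e * (κ z e)⁻¹,
    (hσ.clm_apply (smoothNear_const e p)).mul (hκe.inv he), ?_⟩
  filter_upwards [h, hκe.continuousAt.eventually_ne he] with x hx hxe
  ext a
  have ha := hx (a - (κ x a * (κ x e)⁻¹) • e) (by simp [hxe])
  simp only [map_sub, map_smul, smul_eq_mul, smul_apply] at ha ⊢
  linear_combination ha

theorem fderiv_exp_const_mul_apply {f : E → ℝ} {x : E} (hf : DifferentiableAt ℝ f x) (c : ℝ)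
    (v : E) : fderiv ℝ (fun z => Real.exp (c * f z)) x v =
      c * Real.exp (c * f x) * fderiv ℝ f x v := by
  rw [(hf.hasFDerivAt.const_mul c).exp.fderiv]
  simp only [smul_apply, smul_eq_mul]
  ring

theorem SmoothNear.exp_const_mul {f : E → ℝ} {p : E} (hf : SmoothNear f p) (c : ℝ) :
    SmoothNear (fun x => Real.exp (c * f x)) p :=
  ((smoothNear_const c p).mul hf).exp

/-- The structure equations at `x` of a coframe `κ, l, m, n` adapted to a Killing spinor with
Killing constant `lam`; the auxiliary one-forms `α` and `β` are unconstrained. -/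
structure AdaptedCoframe (lam : ℝ) (κ l m n : E → E →L[ℝ] ℝ) (α β : E →L[ℝ] ℝ) (x : E) :
    Prop where
  extD_κ : ∀ v w, extD κ x v w = 2 * lam * wedge (l x) (κ x) v w
  extD_l : ∀ v w, extD l x v w = wedge α (κ x) v w
  extD_m : ∀ v w, extD m x v w = lam * wedge (l x) (m x) v w + wedge β (κ x) v w
  extD_n : ∀ v w, extD n x v w = -wedge α (l x) v w - wedge β (m x) v w

variable {lam : ℝ} {κ l m n : E → E →L[ℝ] ℝ} {p x : E}

theorem extD_eq_zero_of_eq_wedge {σ : E →L[ℝ] ℝ} {c : ℝ}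
    (hdκ : ∀ v w, extD κ x v w = c * wedge σ (κ x) v w) (v w : E) (hv : κ x v = 0)
    (hw : κ x w = 0) : extD κ x v w = 0 := by
  simp [hdκ, wedge, hv, hw]

theorem exists_eq_exp_smul_fderiv [FiniteDimensional ℝ E] (hκ : SmoothNear κ p) (hκp : κ p ≠ 0)
    (hdκ : ∀ᶠ x in 𝓝 p, ∀ v w, κ x v = 0 → κ x w = 0 → extD κ x v w = 0) :
    ∃ u F : E → ℝ, SmoothNear u p ∧ SmoothNear F p ∧
      ∀ᶠ x in 𝓝 p, κ x = Real.exp (F x) • fderiv ℝ u x := by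
  obtain ⟨u, _, hu, _, hup, hleaf⟩ := exists_leafwise_primitive hκ hκ hκp hdκ hdκ
  obtain ⟨c, hc, huc⟩ := exists_smooth_factor hu.fderiv hκ hκp
    (hleaf.mono fun x hx a ha => (hx a ha).1)
  have hcp : c p = 1 := by
    obtain ⟨e, he⟩ := exists_apply_ne_zero hκp
    simpa [hup, he] using congrArg (· e) huc.self_of_nhds
  have hcpos : ∀ᶠ x in 𝓝 p, 0 < c x := hc.continuousAt.eventually (lt_mem_nhds (by simp [hcp]))
  refine ⟨u, fun x => -Real.log (c x), hu, ?_, ?_⟩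
  · filter_upwards [hc, hcpos] with x hx hpos using (hx.log hpos.ne').neg
  · filter_upwards [huc, hcpos] with x hx hpos
    rw [hx, Real.exp_neg, Real.exp_log hpos, smul_smul, inv_mul_cancel₀ hpos.ne', one_smul]

theorem exists_null_coordinate [FiniteDimensional ℝ E] (hlam : lam ≠ 0)
    (hκ : SmoothNear κ p) (hl : SmoothNear l p) (hκp : κ p ≠ 0)
    (hdκ : ∀ᶠ x in 𝓝 p, ∀ v w, extD κ x v w = 2 * lam * wedge (l x) (κ x) v w) :
    ∃ u F A : E → ℝ, SmoothNear u p ∧ SmoothNear F p ∧ SmoothNear A p ∧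
      (∀ᶠ x in 𝓝 p, κ x = Real.exp (F x) • fderiv ℝ u x) ∧
      ∀ᶠ x in 𝓝 p, fderiv ℝ F x = (2 * lam) • (l x + A x • κ x) := by
  obtain ⟨u, F, hu, hF, hκF⟩ := exists_eq_exp_smul_fderiv hκ hκp
    (hdκ.mono fun x hx => extD_eq_zero_of_eq_wedge hx)
  obtain ⟨A, hA, hFA⟩ := exists_smooth_factor
    (((smoothNear_const (2 * lam)⁻¹ p).smul hF.fderiv).sub hl) hκ hκp (by
    filter_upwards [hdκ, hF.eventually_differentiableAt, hu,
      hu.fderiv.eventually_differentiableAt, eventually_eventually_nhds.2 hκF,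
      hκ.continuousAt.eventually_ne hκp] with x hdκx hFx hux hdux hκFx hκx a ha
    refine apply_eq_zero_of_wedge_eq_zero hκx (fun v w => ?_) ha
    have hdF : wedge (fderiv ℝ F x) (κ x) v w = extD κ x v w := by
      rw [extD_congr hκFx, extD_smul hFx.exp hdux, extD_fderiv hux, hκFx.self_of_nhds]
      simp only [wedge, fderiv_exp hFx, smul_apply, smul_eq_mul]
      ring
    rw [hdκx] at hdF
    simp only [wedge, sub_apply, smul_apply, smul_eq_mul] at hdF ⊢
    field_simp
    linear_combination hdF)
  refine ⟨u, F, A, hu, hF, hA, hκF, ?_⟩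
  filter_upwards [hFA] with x hx
  rw [← hx, add_sub_cancel, smul_smul, mul_inv_cancel₀ (by simpa using hlam), one_smul]

theorem exists_screen_coordinate [FiniteDimensional ℝ E] {F A : E → ℝ}
    (hκ : SmoothNear κ p) (hm : SmoothNear m p) (hF : SmoothNear F p) (hκp : κ p ≠ 0)
    (hdF : ∀ᶠ x in 𝓝 p, fderiv ℝ F x = (2 * lam) • (l x + A x • κ x))
    (hE : ∀ᶠ x in 𝓝 p, ∃ α β, AdaptedCoframe lam κ l m n α β x) :
    ∃ G B : E → ℝ, SmoothNear G p ∧ SmoothNear B p ∧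
      ∀ᶠ x in 𝓝 p, Real.exp (2⁻¹ * F x) • fderiv ℝ G x = m x + B x • κ x := by
  have hexp := hF.exp_const_mul (-2⁻¹)
  obtain ⟨_, G, _, hG, _, hleaf⟩ := exists_leafwise_primitive hκ (hexp.smul hm) hκp
    (hE.mono fun x ⟨α, β, hx⟩ => extD_eq_zero_of_eq_wedge hx.extD_κ) (by
      filter_upwards [hE, hexp.eventually_differentiableAt, hm.eventually_differentiableAt, hdF,
        hF.eventually_differentiableAt] with x ⟨α, β, hx⟩ hexpx hmx hdFx hFx v w hv hw
      rw [extD_smul hexpx hmx, hx.extD_m]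
      simp only [wedge, fderiv_exp_const_mul_apply hFx, hdFx, add_apply, smul_apply, smul_eq_mul,
        hv, hw]
      ring)
  obtain ⟨B, hB, hGB⟩ := exists_smooth_factor
    (((hF.exp_const_mul 2⁻¹).smul hG.fderiv).sub hm) hκ hκp (by
    filter_upwards [hleaf] with x hx a ha
    have hcancel : Real.exp (2⁻¹ * F x) * Real.exp (-2⁻¹ * F x) = 1 := by
      rw [← Real.exp_add, neg_mul, add_neg_cancel, Real.exp_zero]
    simp only [sub_apply, smul_apply, smul_eq_mul, (hx a ha).2]
    linear_combination m x a * hcancel)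
  refine ⟨G, B, hG, hB, ?_⟩
  filter_upwards [hGB] with x hx
  rw [← hx, add_sub_cancel]

/-- The form `n` after the null rotation which fixes `κ`, replaces `l` and `m` by `l + A κ` and
`m + B κ`, and preserves the metric. -/
def rotatedNull (A B : E → ℝ) (κ l m n : E → E →L[ℝ] ℝ) (x : E) : E →L[ℝ] ℝ :=
  n x + (-A x) • l x + (-B x) • m x + (-(A x ^ 2 + B x ^ 2) / 2) • κ x

theorem SmoothNear.rotatedNull {A B : E → ℝ} (hA : SmoothNear A p) (hB : SmoothNear B p)
    (hκ : SmoothNear κ p) (hl : SmoothNear l p) (hm : SmoothNear m p) (hn : SmoothNear n p) :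
    SmoothNear (rotatedNull A B κ l m n) p := by
  filter_upwards [hA, hB, hκ, hl, hm, hn] with x hAx hBx hκx hlx hmx hnx
  unfold SusyKundt.rotatedNull
  fun_prop

theorem extD_rotatedNull {A B : E → ℝ} (hA : DifferentiableAt ℝ A x) (hB : DifferentiableAt ℝ B x)
    (hκ : DifferentiableAt ℝ κ x) (hl : DifferentiableAt ℝ l x) (hm : DifferentiableAt ℝ m x)
    (hn : DifferentiableAt ℝ n x) (v w : E) :
    extD (rotatedNull A B κ l m n) x v w = extD n x v w
      - (wedge (fderiv ℝ A x) (l x) v w + A x * extD l x v w)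
      - (wedge (fderiv ℝ B x) (m x) v w + B x * extD m x v w)
      - (A x * wedge (fderiv ℝ A x) (κ x) v w + B x * wedge (fderiv ℝ B x) (κ x) v w
        + (A x ^ 2 + B x ^ 2) / 2 * extD κ x v w) := by
  have hquad : HasFDerivAt (fun z => -(A z ^ 2 + B z ^ 2) / 2)
      (-(A x • fderiv ℝ A x + B x • fderiv ℝ B x)) x := by
    refine ((((hA.hasFDerivAt.pow 2).add (hB.hasFDerivAt.pow 2)).neg.const_mul
      (2 : ℝ)⁻¹).congr_fderiv ?_).congr_of_eventuallyEq (.of_forall fun z => ?_)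
    · ext v
      simp only [Nat.add_one_sub_one, pow_one, nsmul_eq_mul, Nat.cast_ofNat, smul_add, neg_add_rev,
        add_apply, neg_apply, smul_apply, smul_eq_mul]
      ring
    · simp [div_eq_inv_mul]
  have hAl : DifferentiableAt ℝ (fun z => (-A z) • l z) x := hA.fun_neg.fun_smul hl
  have hBm : DifferentiableAt ℝ (fun z => (-B z) • m z) x := hB.fun_neg.fun_smul hm
  unfold rotatedNull
  rw [extD_add ((hn.fun_add hAl).fun_add hBm) (hquad.differentiableAt.fun_smul hκ),
    extD_add (hn.fun_add hAl) hBm, extD_add hn hAl, extD_smul hA.fun_neg hl,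
    extD_smul hB.fun_neg hm, extD_smul hquad.differentiableAt hκ, hquad.fderiv]
  simp only [wedge, fderiv_fun_neg, neg_apply, add_apply, smul_apply, smul_eq_mul]
  ring

variable {A B u v F G H : E → ℝ} {α β : E →L[ℝ] ℝ}

theorem apply_of_fderiv_eq_null (hlam : lam ≠ 0) (hκ : DifferentiableAt ℝ κ x)
    (hl : DifferentiableAt ℝ l x) (hA : DifferentiableAt ℝ A x) (hF : ContDiffAt ℝ ∞ F x)
    (hκx : κ x ≠ 0) (hdF : ∀ᶠ z in 𝓝 x, fderiv ℝ F z = (2 * lam) • (l z + A z • κ z))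
    (hE : AdaptedCoframe lam κ l m n α β x) {a : E} (ha : κ x a = 0) :
    α a = -fderiv ℝ A x a - 2 * lam * A x * l x a := by
  have hclosed : ∀ v w, extD (fun z => (2 * lam) • (l z + A z • κ z)) x v w = 0 := fun v w => by
    rw [← extD_congr hdF, extD_fderiv hF]
  have hzero : ∀ v w, wedge (α + fderiv ℝ A x + (2 * lam * A x) • l x) (κ x) v w = 0 := by
    intro v w
    have hvw := hclosed v w
    rw [extD_smul (f := fun _ => 2 * lam) (differentiableAt_const _)
      (hl.fun_add (hA.fun_smul hκ)), extD_add hl (hA.fun_smul hκ), extD_smul hA hκ, hE.extD_l,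
      hE.extD_κ, fderiv_fun_const] at hvw
    have h2lam : 2 * lam ≠ 0 := by simpa using hlam
    refine (mul_eq_zero.1 (?_ : 2 * lam * _ = 0)).resolve_left h2lam
    simp only [wedge, Pi.zero_apply, add_apply, smul_apply, zero_apply, smul_eq_mul] at hvw ⊢
    linear_combination hvw
  have := apply_eq_zero_of_wedge_eq_zero hκx hzero ha
  simp only [add_apply, smul_apply, smul_eq_mul] at this
  linear_combination this

theorem apply_of_fderiv_eq_screen (hκ : DifferentiableAt ℝ κ x) (hm : DifferentiableAt ℝ m x)
    (hB : DifferentiableAt ℝ B x) (hF : DifferentiableAt ℝ F x) (hG : SmoothNear G x)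
    (hκx : κ x ≠ 0) (hdF : fderiv ℝ F x = (2 * lam) • (l x + A x • κ x))
    (hdG : ∀ᶠ z in 𝓝 x, Real.exp (2⁻¹ * F z) • fderiv ℝ G z = m z + B z • κ z)
    (hE : AdaptedCoframe lam κ l m n α β x) {a : E} (ha : κ x a = 0) :
    β a = -fderiv ℝ B x a - lam * B x * l x a - lam * A x * m x a := by
  have hzero : ∀ v w, wedge (β + fderiv ℝ B x + (lam * B x) • l x + (lam * A x) • m x)
      (κ x) v w = 0 := by
    intro v w
    have hvw := extD_congr hdG v w
    have hG_eq (v : E) : Real.exp (2⁻¹ * F x) * fderiv ℝ G x v = m x v + B x * κ x v := by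
      simpa using congrArg (· v) hdG.self_of_nhds
    rw [extD_add hm (hB.fun_smul hκ), extD_smul hB hκ,
      extD_smul (hF.const_mul 2⁻¹).exp hG.fderiv.differentiableAt,
      extD_fderiv hG.contDiffAt, hE.extD_m, hE.extD_κ] at hvw
    simp only [wedge, fderiv_exp_const_mul_apply hF, hdF, add_apply, smul_apply,
      smul_eq_mul] at hvw ⊢
    linear_combination -hvw + lam * (l x v + A x * κ x v) * hG_eq w -
      lam * (l x w + A x * κ x w) * hG_eq v
  have := apply_eq_zero_of_wedge_eq_zero hκx hzero ha
  simp only [add_apply, smul_apply, smul_eq_mul] at this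
  linear_combination this

theorem eventually_extD_rotatedNull_eq_zero (hlam : lam ≠ 0) (hκ : SmoothNear κ p)
    (hl : SmoothNear l p) (hm : SmoothNear m p) (hn : SmoothNear n p) (hF : SmoothNear F p)
    (hG : SmoothNear G p) (hA : SmoothNear A p) (hB : SmoothNear B p) (hκp : κ p ≠ 0)
    (hdF : ∀ᶠ x in 𝓝 p, fderiv ℝ F x = (2 * lam) • (l x + A x • κ x))
    (hdG : ∀ᶠ x in 𝓝 p, Real.exp (2⁻¹ * F x) • fderiv ℝ G x = m x + B x • κ x)
    (hE : ∀ᶠ x in 𝓝 p, ∃ α β, AdaptedCoframe lam κ l m n α β x) :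
    ∀ᶠ x in 𝓝 p, ∀ a b, κ x a = 0 → (κ x b = 0 ∨ l x a = 0 ∧ m x a = 0) →
      extD (rotatedNull A B κ l m n) x a b = 0 := by
  filter_upwards [hκ.eventually_differentiableAt, hl.eventually_differentiableAt,
    hm.eventually_differentiableAt, hn.eventually_differentiableAt, hF,
    eventually_eventually_nhds.2 hG, hA.eventually_differentiableAt,
    hB.eventually_differentiableAt, eventually_eventually_nhds.2 hdF,
    eventually_eventually_nhds.2 hdG, hE, hκ.continuousAt.eventually_ne hκp]
    with x hκx hlx hmx hnx hFx hGx hAx hBx hdFx hdGx ⟨α, β, hx⟩ hne a b ha hab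
  have hα {a} := apply_of_fderiv_eq_null (a := a) hlam hκx hlx hAx hFx hne hdFx hx
  have hβ {a} := apply_of_fderiv_eq_screen (a := a) hκx hmx hBx (hFx.differentiableAt (by simp))
    hGx hne hdFx.self_of_nhds hdGx hx
  rw [extD_rotatedNull hAx hBx hκx hlx hmx hnx, hx.extD_κ, hx.extD_l, hx.extD_m, hx.extD_n]
  rcases hab with hb | ⟨hla, hma⟩
  · simp only [wedge, ha, hb, hα ha, hα hb, hβ ha, hβ hb]
    ring
  · simp only [wedge, ha, hla, hma, hα ha, hβ ha]
    ring

/-- The functions `u, v, F, G, H` integrate the coframe `κ, l, m, n` at `x`, up to the null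
rotation with parameters `A, B`. -/
structure IsIntegratedBy (lam : ℝ) (κ l m n : E → E →L[ℝ] ℝ) (A B u v F G H : E → ℝ) (x : E) :
    Prop where
  eq_κ : κ x = Real.exp (F x) • fderiv ℝ u x
  eq_l : fderiv ℝ F x = (2 * lam) • (l x + A x • κ x)
  eq_m : Real.exp (2⁻¹ * F x) • fderiv ℝ G x = m x + B x • κ x
  eq_n : rotatedNull A B κ l m n x = fderiv ℝ v x + H x • fderiv ℝ u x

theorem exists_isIntegratedBy [FiniteDimensional ℝ E] (hlam : lam ≠ 0) (hκ : SmoothNear κ p)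
    (hl : SmoothNear l p) (hm : SmoothNear m p) (hn : SmoothNear n p) (hκp : κ p ≠ 0)
    (hE : ∀ᶠ x in 𝓝 p, ∃ α β, AdaptedCoframe lam κ l m n α β x) :
    ∃ A B u v F G H : E → ℝ, (SmoothNear u p ∧ SmoothNear v p ∧ SmoothNear F p ∧
      SmoothNear G p ∧ SmoothNear H p) ∧
      (∀ᶠ x in 𝓝 p, IsIntegratedBy lam κ l m n A B u v F G H x) ∧
      ∀ᶠ x in 𝓝 p, ∀ a b, κ x a = 0 → l x a = 0 → m x a = 0 →
        extD (rotatedNull A B κ l m n) x a b = 0 := by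
  have hdκ : ∀ᶠ x in 𝓝 p, ∀ v w, extD κ x v w = 2 * lam * wedge (l x) (κ x) v w :=
    hE.mono fun x ⟨_, _, hx⟩ => hx.extD_κ
  obtain ⟨u, F, A, hu, hF, hA, hκu, hdF⟩ := exists_null_coordinate hlam hκ hl hκp hdκ
  obtain ⟨G, B, hG, hB, hdG⟩ := exists_screen_coordinate hκ hm hF hκp hdF hE
  have hdN := eventually_extD_rotatedNull_eq_zero hlam hκ hl hm hn hF hG hA hB hκp hdF hdG hE
  have hN := SmoothNear.rotatedNull hA hB hκ hl hm hn
  obtain ⟨_, v, _, hv, _, hleaf⟩ := exists_leafwise_primitive hκ hN hκp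
    (hdκ.mono fun x hx => extD_eq_zero_of_eq_wedge hx)
    (hdN.mono fun x hx a b ha hb => hx a b ha (.inl hb))
  have hup : fderiv ℝ u p ≠ 0 := fun h => hκp (by rw [hκu.self_of_nhds, h, smul_zero])
  obtain ⟨H, hH, hNv⟩ := exists_smooth_factor (hN.sub hv.fderiv) hu.fderiv hup (by
    filter_upwards [hleaf, hκu] with x hx hκx a ha
    rw [sub_apply, (hx a (by simp [hκx, ha])).2, sub_self])
  refine ⟨A, B, u, v, F, G, H, ⟨hu, hv, hF, hG, hH⟩, ?_,
    hdN.mono fun x hx a b ha hla hma => hx a b ha (.inr ⟨hla, hma⟩)⟩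
  filter_upwards [hκu, hdF, hdG, hNv] with x hκx hdFx hdGx hNx
  exact ⟨hκx, hdFx, hdGx, by rw [← hNx, add_sub_cancel]⟩

namespace IsIntegratedBy

variable (h : IsIntegratedBy lam κ l m n A B u v F G H x)
include h

theorem apply_eq_zero (hlam : lam ≠ 0) {a : E} (hu : fderiv ℝ u x a = 0) (hF : fderiv ℝ F x a = 0)
    (hG : fderiv ℝ G x a = 0) : κ x a = 0 ∧ l x a = 0 ∧ m x a = 0 := by
  have hκ : κ x a = 0 := by simp [h.eq_κ, hu]
  refine ⟨hκ, ?_, ?_⟩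
  · simpa [h.eq_l, hκ, hlam] using hF
  · simpa [hG, hκ] using (congrArg (· a) h.eq_m).symm

theorem eq_zero_of_fderiv_apply_eq_zero (hlam : lam ≠ 0)
    (hinj : ∀ a, κ x a = 0 → l x a = 0 → m x a = 0 → n x a = 0 → a = 0) {a : E}
    (hu : fderiv ℝ u x a = 0) (hv : fderiv ℝ v x a = 0) (hF : fderiv ℝ F x a = 0)
    (hG : fderiv ℝ G x a = 0) : a = 0 := by
  obtain ⟨hκ, hl, hm⟩ := h.apply_eq_zero hlam hu hF hG
  refine hinj a hκ hl hm ?_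
  simpa [rotatedNull, hκ, hl, hm, hu, hv] using congrArg (· a) h.eq_n

theorem metric_apply (hlam : lam ≠ 0) (a b : E) :
    κ x a * n x b + n x a * κ x b + l x a * l x b + m x a * m x b =
      Real.exp (F x) * (fderiv ℝ u x a * (fderiv ℝ v x b + H x * fderiv ℝ u x b)
        + (fderiv ℝ v x a + H x * fderiv ℝ u x a) * fderiv ℝ u x b)
      + 1 / (4 * lam ^ 2) * (fderiv ℝ F x a * fderiv ℝ F x b)
      + Real.exp (F x) * (fderiv ℝ G x a * fderiv ℝ G x b) := by
  have hκ (a : E) : Real.exp (F x) * fderiv ℝ u x a = κ x a := by simp [h.eq_κ]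
  have hl (a : E) : fderiv ℝ F x a = 2 * lam * (l x a + A x * κ x a) := by
    simp [h.eq_l, mul_add]
  have hm (a : E) : Real.exp (2⁻¹ * F x) * fderiv ℝ G x a = m x a + B x * κ x a := by
    simpa using congrArg (· a) h.eq_m
  have hn (a : E) : fderiv ℝ v x a + H x * fderiv ℝ u x a = n x a - A x * l x a - B x * m x a
      - (A x ^ 2 + B x ^ 2) / 2 * κ x a := by
    have := congrArg (· a) h.eq_n
    simp only [rotatedNull, add_apply, smul_apply, smul_eq_mul] at this
    linear_combination -this
  have hGG : Real.exp (F x) * (fderiv ℝ G x a * fderiv ℝ G x b) =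
      (m x a + B x * κ x a) * (m x b + B x * κ x b) := by
    rw [← hm, ← hm, show F x = 2⁻¹ * F x + 2⁻¹ * F x by ring, Real.exp_add]
    ring_nf
  have hFF : 1 / (4 * lam ^ 2) * (fderiv ℝ F x a * fderiv ℝ F x b) =
      (l x a + A x * κ x a) * (l x b + A x * κ x b) := by
    rw [hl, hl]
    field
  rw [hGG, hFF, hn, hn]
  linear_combination -(n x b - A x * l x b - B x * m x b - (A x ^ 2 + B x ^ 2) / 2 * κ x b) * hκ a
    - (n x a - A x * l x a - B x * m x a - (A x ^ 2 + B x ^ 2) / 2 * κ x a) * hκ b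

end IsIntegratedBy

theorem fderiv_apply_eq_zero_of_extD_eq_zero {N : E → E →L[ℝ] ℝ} (hu : SmoothNear u x)
    (hv : SmoothNear v x) (hH : DifferentiableAt ℝ H x) (hux : fderiv ℝ u x ≠ 0)
    (hN : ∀ᶠ z in 𝓝 x, N z = fderiv ℝ v z + H z • fderiv ℝ u z) {a : E}
    (ha : fderiv ℝ u x a = 0) (hdN : ∀ b, extD N x a b = 0) : fderiv ℝ H x a = 0 := by
  obtain ⟨e, he⟩ := exists_apply_ne_zero hux
  have hu' := hu.fderiv.differentiableAt
  have hae := hdN e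
  rw [extD_congr hN, extD_add hv.fderiv.differentiableAt (hH.fun_smul hu'), extD_smul hH hu',
    extD_fderiv hu.contDiffAt, extD_fderiv hv.contDiffAt, wedge, ha] at hae
  simpa [he] using hae

end Coframe

/-- The functions `u, v, F, G` are coordinates near `p` in which the metric `q` is of Siklos form
`e ^ F (du ⊙ (dv + H du) + dG ⊗ dG) + (4λ²)⁻¹ dF ⊗ dF`, with a profile `H` independent of `v`. -/
structure IsSiklosSystem {E : Type*} [NormedAddCommGroup E] [NormedSpace ℝ E] (lam : ℝ)
    (q : E → E → E → ℝ) (u v F G H : E → ℝ) (p : E) : Prop where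
  smooth_u : SmoothNear u p
  smooth_v : SmoothNear v p
  smooth_F : SmoothNear F p
  smooth_G : SmoothNear G p
  smooth_H : SmoothNear H p
  separating : ∀ a, fderiv ℝ u p a = 0 → fderiv ℝ v p a = 0 → fderiv ℝ F p a = 0 →
    fderiv ℝ G p a = 0 → a = 0
  fderiv_H : ∀ᶠ x in 𝓝 p, ∀ a, fderiv ℝ u x a = 0 → fderiv ℝ F x a = 0 → fderiv ℝ G x a = 0 →
    fderiv ℝ H x a = 0
  metric_eq : ∀ᶠ x in 𝓝 p, ∀ a b, q x a b =
    Real.exp (F x) * (fderiv ℝ u x a * (fderiv ℝ v x b + H x * fderiv ℝ u x b)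
      + (fderiv ℝ v x a + H x * fderiv ℝ u x a) * fderiv ℝ u x b)
    + 1 / (4 * lam ^ 2) * (fderiv ℝ F x a * fderiv ℝ F x b)
    + Real.exp (F x) * (fderiv ℝ G x a * fderiv ℝ G x b)

theorem exists_isSiklosSystem {E : Type u} [NormedAddCommGroup E] [NormedSpace ℝ E]
    [FiniteDimensional ℝ E] {lam : ℝ} {κ l m n : E → E →L[ℝ] ℝ} {p : E} (hlam : lam ≠ 0)
    (hκ : SmoothNear κ p) (hl : SmoothNear l p) (hm : SmoothNear m p) (hn : SmoothNear n p)
    (hκp : κ p ≠ 0) (hinj : ∀ a, κ p a = 0 → l p a = 0 → m p a = 0 → n p a = 0 → a = 0)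
    (hE : ∀ᶠ x in 𝓝 p, ∃ α β, AdaptedCoframe lam κ l m n α β x) :
    ∃ u v F G H : E → ℝ, IsSiklosSystem lam
      (fun x a b => κ x a * n x b + n x a * κ x b + l x a * l x b + m x a * m x b)
      u v F G H p := by
  obtain ⟨A, B, u, v, F, G, H, ⟨hu, hv, hF, hG, hH⟩, hI, hdN⟩ :=
    exists_isIntegratedBy hlam hκ hl hm hn hκp hE
  refine ⟨u, v, F, G, H, hu, hv, hF, hG, hH,
    fun a => hI.self_of_nhds.eq_zero_of_fderiv_apply_eq_zero hlam hinj, ?_,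
    hI.mono fun x hx => hx.metric_apply hlam⟩
  have hup : fderiv ℝ u p ≠ 0 := fun h => hκp (by rw [hI.self_of_nhds.eq_κ, h, smul_zero])
  filter_upwards [eventually_eventually_nhds.2 hI, hdN, eventually_eventually_nhds.2 hu,
    eventually_eventually_nhds.2 hv, hH.eventually_differentiableAt,
    hu.fderiv.continuousAt.eventually_ne hup] with x hIx hdNx hux hvx hHx hne a hua hFa hGa
  obtain ⟨hκa, hla, hma⟩ := hIx.self_of_nhds.apply_eq_zero hlam hua hFa hGa
  exact fderiv_apply_eq_zero_of_extD_eq_zero hux hvx hHx hne (hIx.mono fun z hz => hz.eq_n) hua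
    fun b => hdNx a b hκa hla hma

theorem IsSiklosSystem.congr_metric {E : Type*} [NormedAddCommGroup E] [NormedSpace ℝ E] {lam : ℝ}
    {q q' : E → E → E → ℝ} {u v F G H : E → ℝ} {p : E} (h : IsSiklosSystem lam q u v F G H p)
    (hq : ∀ᶠ x in 𝓝 p, ∀ a b, q' x a b = q x a b) : IsSiklosSystem lam q' u v F G H p :=
  { h with
    metric_eq := by
      filter_upwards [h.metric_eq, hq] with x hx hqx a b
      rw [hqx, hx] }

section PlaneFamilies

theorem dX_coord (j : Fin 2) (y : Fin 2 → ℝ) : dX (fun z => z j) y = Pi.single j 1 := by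
  ext i
  rw [dX, fderiv_apply differentiableAt_fun_id]
  simp [Pi.single_apply, eq_comm]

theorem linearIndependent_dX_coord (y : Fin 2 → ℝ) :
    LinearIndependent ℝ ![dX (fun z => z 0) y, dX (fun z => z 1) y] := by
  rw [dX_coord, dX_coord, LinearIndependent.pair_iff]
  intro s t h
  exact ⟨by simpa using congrFun h 0, by simpa using congrFun h 1⟩

theorem hodge_zero (q : Matrix (Fin 2) (Fin 2) ℝ) : hodge q 0 = 0 := by
  ext i
  fin_cases i <;> simp [hodge]

theorem betaEquation_coord (lam : ℝ) :
    BetaEquation lam (fun _ y => y 0) (fun _ y => y 1) (fun _ _ => 0) := by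
  intro u y
  have hdX : dX (fun _ => (0 : ℝ)) y = 0 := by
    ext i
    simp [dX]
  simp [dXOneForm, planeMetric, deriv_const, hodge_zero, hdX, coInner]

theorem kundtMetric_coord (lam : ℝ) (H : ℝ → (Fin 2 → ℝ) → ℝ) (p v w : EuclideanSpace ℝ (Fin 4)) :
    kundtMetric lam H (fun _ y => y 0) (fun _ y => y 1) (fun _ _ => 0) p v w =
      H (p 0) ![p 2, p 3] * (v 0 * w 0) + Real.exp (p 2) * (v 0 * w 1 + v 1 * w 0)
        + 1 / (4 * lam ^ 2) * (v 2 * w 2) + Real.exp (p 2) * (v 3 * w 3) := by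
  simp [kundtMetric, dX_coord]

end PlaneFamilies

section CoordMap

/-- The map to Euclidean space with coordinate functions `f i`. -/
def coordMap {ι E : Type*} (f : ι → E → ℝ) (x : E) : EuclideanSpace ℝ ι :=
  WithLp.toLp 2 fun i => f i x

@[simp]
theorem coordMap_apply {ι E : Type*} (f : ι → E → ℝ) (x : E) (i : ι) : coordMap f x i = f i x := rfl

variable {ι : Type*} {E : Type*} [NormedAddCommGroup E] [NormedSpace ℝ E]
  {f : ι → E → ℝ} {p x : E}

theorem smoothNear_coordMap [Fintype ι] (hf : ∀ i, SmoothNear (f i) p) :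
    SmoothNear (coordMap f) p :=
  (eventually_all.2 hf).mono fun _ hx => contDiffAt_euclidean.2 hx

theorem fderiv_coordMap_apply [Finite ι] (hf : DifferentiableAt ℝ (coordMap f) x) (a : E) (i : ι) :
    fderiv ℝ (coordMap f) x a i = fderiv ℝ (f i) x a := by
  have := Fintype.ofFinite ι
  exact congrArg (· a)
    ((EuclideanSpace.proj (𝕜 := ℝ) i).hasFDerivAt.comp x hf.hasFDerivAt).fderiv.symm

theorem exists_openPartialHomeomorph_coordMap [Fintype ι] [FiniteDimensional ℝ E]
    (hdim : Module.finrank ℝ E = Fintype.card ι) (hf : ∀ i, SmoothNear (f i) p)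
    (hsep : ∀ a, (∀ i, fderiv ℝ (f i) p a = 0) → a = 0) :
    ∃ Θ : OpenPartialHomeomorph E (EuclideanSpace ℝ ι), ⇑Θ = coordMap f ∧ p ∈ Θ.source ∧
      (∀ x ∈ Θ.source, ContDiffAt ℝ ∞ (coordMap f) x) ∧
      ∀ y ∈ Θ.target, ContDiffAt ℝ ∞ Θ.symm y := by
  have hΨ := smoothNear_coordMap hf
  let D := fderiv ℝ (coordMap f) p
  have hinj : Function.Injective D := by
    refine (injective_iff_map_eq_zero D).2 fun a ha => hsep a fun i => ?_
    rw [← fderiv_coordMap_apply hΨ.differentiableAt]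
    exact congrArg (· i) ha
  let T : E ≃L[ℝ] EuclideanSpace ℝ ι :=
    (LinearEquiv.ofInjectiveOfFinrankEq D.toLinearMap hinj (by simpa)).toContinuousLinearEquiv
  exact hΨ.exists_openPartialHomeomorph T hΨ.differentiableAt.hasFDerivAt

end CoordMap

/-- The model space of four-manifolds. -/
local notation "E4" => EuclideanSpace ℝ (Fin 4)

section KundtChart

theorem eventually_apply_sub_smul_eq {E : Type*} [NormedAddCommGroup E] [NormedSpace ℝ E]
    {K s : E → ℝ} {c e : E} (hK : ∀ᶠ y in 𝓝 c, DifferentiableAt ℝ K y ∧ fderiv ℝ K y e = 0)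
    (hs : ContinuousAt s c) (hsc : s c = 0) : ∀ᶠ y in 𝓝 c, K (y - s y • e) = K y := by
  obtain ⟨r, hr, hball⟩ := Metric.eventually_nhds_iff_ball.1 hK
  have hshift : Tendsto (fun y => y - s y • e) (𝓝 c) (𝓝 c) := by
    have : ContinuousAt (fun y => y - s y • e) c := by fun_prop
    simpa [ContinuousAt, hsc] using this
  filter_upwards [Metric.ball_mem_nhds c hr, hshift (Metric.ball_mem_nhds c hr)] with y hy hy'
  obtain ⟨z, hz, hmean⟩ := domain_mvt
    (fun z hz => (hball z hz).1.hasFDerivAt.hasFDerivWithinAt) (convex_ball c r) hy hy'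
  have hze := (hball z ((convex_ball c r).segment_subset hy hy' hz)).2
  rw [sub_sub_cancel_left, map_neg, map_smul, hze, smul_zero, neg_zero] at hmean
  exact sub_eq_zero.1 hmean

theorem exists_contDiff_eventuallyEq_of_fderiv_single_eq_zero {K : E4 → ℝ} {c : E4}
    (hK : SmoothNear K c)
    (hK₁ : ∀ᶠ y in 𝓝 c, fderiv ℝ K y (EuclideanSpace.single 1 1) = 0) :
    ∃ k : ℝ × (Fin 2 → ℝ) → ℝ, ContDiff ℝ ∞ k ∧ ∀ᶠ y in 𝓝 c, k (y 0, ![y 2, y 3]) = K y := by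
  let S : ℝ × (Fin 2 → ℝ) → E4 := fun z => !₂[z.1, c 1, z.2 0, z.2 1]
  let π : E4 → ℝ × (Fin 2 → ℝ) := fun y => (y 0, ![y 2, y 3])
  have hS : ContDiff ℝ ∞ S := by
    refine contDiff_euclidean.2 fun i => ?_
    fin_cases i
    exacts [contDiff_fst, contDiff_const, (contDiff_apply ℝ ℝ 0).comp contDiff_snd,
      (contDiff_apply ℝ ℝ 1).comp contDiff_snd]
  have hπ : Continuous π := by fun_prop
  have hSπ (y) : S (π y) = y - (y 1 - c 1) • EuclideanSpace.single 1 1 := by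
    ext i
    fin_cases i <;> simp [S, π]
  have hKS : SmoothNear (fun z => K (S z)) (π c) :=
    SmoothNear.comp (by simpa [hSπ] using hK) (smoothNear_of_contDiff hS _)
  obtain ⟨k, hk, hkK⟩ := hKS.exists_contDiff_eventuallyEq
  refine ⟨k, hk, ?_⟩
  filter_upwards [hπ.continuousAt.eventually hkK, eventually_apply_sub_smul_eq
    (hK.eventually_differentiableAt.and hK₁) (s := fun y => y 1 - c 1) (by fun_prop) (sub_self _)]
    with y hky hKy
  exact hky.trans ((congrArg K (hSπ y)).trans hKy)

theorem fderiv_comp_symm_apply_eq_zero {E F : Type*} [NormedAddCommGroup E] [NormedSpace ℝ E]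
    [NormedAddCommGroup F] [NormedSpace ℝ F] {Θ : OpenPartialHomeomorph E F} {H : E → ℝ} {y e : F}
    (hy : y ∈ Θ.target) (hΘ : DifferentiableAt ℝ Θ (Θ.symm y))
    (hΘs : DifferentiableAt ℝ Θ.symm y) (hH : DifferentiableAt ℝ H (Θ.symm y))
    (h : ∀ a, fderiv ℝ Θ (Θ.symm y) a = e → fderiv ℝ H (Θ.symm y) a = 0) :
    fderiv ℝ (fun z => H (Θ.symm z)) y e = 0 := by
  have hright : fderiv ℝ Θ (Θ.symm y) (fderiv ℝ Θ.symm y e) = e := by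
    have := fderiv_symm_comp_apply (g := id) (Θ := Θ.symm) hy hΘs hΘ differentiableAt_id e
    rwa [fderiv_id] at this
  rw [fderiv_fun_comp y hH hΘs]
  exact h _ hright

/-- `Θ` is a smooth chart in which `q` is the metric `kundtMetric` with profile `H`, for the
constant families `F = y₀`, `G = y₁` and `β = 0`. -/
structure IsKundtChart (lam : ℝ) (q : E4 → E4 → E4 → ℝ) (H : ℝ → (Fin 2 → ℝ) → ℝ)
    (Θ : OpenPartialHomeomorph E4 E4) : Prop where
  contDiffAt : ∀ x ∈ Θ.source, ContDiffAt ℝ ∞ Θ x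
  contDiffAt_symm : ∀ y ∈ Θ.target, ContDiffAt ℝ ∞ Θ.symm y
  metric_eq : ∀ x ∈ Θ.source, ∀ a b, q x a b =
    kundtMetric lam H (fun _ y => y 0) (fun _ y => y 1) (fun _ _ => 0) (Θ x)
      (fderiv ℝ Θ x a) (fderiv ℝ Θ x b)

namespace IsSiklosSystem

variable {lam : ℝ} {q : E4 → E4 → E4 → ℝ} {u v F G H : E4 → ℝ} {p : E4}
  (h : IsSiklosSystem lam q u v F G H p)
include h

theorem smoothNear_coord (i : Fin 4) : SmoothNear (![u, v, F, G] i) p := by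
  fin_cases i
  exacts [h.smooth_u, h.smooth_v, h.smooth_F, h.smooth_G]

theorem eventually_fderiv_coordMap_apply : ∀ᶠ x in 𝓝 p, ∀ a i,
    fderiv ℝ (coordMap ![u, v, F, G]) x a i = fderiv ℝ (![u, v, F, G] i) x a :=
  (smoothNear_coordMap h.smoothNear_coord).eventually_differentiableAt.mono fun _ hx =>
    fderiv_coordMap_apply hx

theorem exists_profile
    {Θ : OpenPartialHomeomorph E4 E4}
    (hΘ : Θ = coordMap ![u, v, F, G]) (hp : p ∈ Θ.source)
    (hΘs : ∀ y ∈ Θ.target, ContDiffAt ℝ ∞ Θ.symm y) :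
    ∃ k : ℝ × (Fin 2 → ℝ) → ℝ, ContDiff ℝ ∞ k ∧ ∀ᶠ x in 𝓝 p, k (u x, ![F x, G x]) = H x := by
  have hΘp := Θ.map_source hp
  have hsymm : Tendsto Θ.symm (𝓝 (Θ p)) (𝓝 p) := by
    simpa only [Θ.left_inv hp] using (Θ.continuousAt_symm hΘp).tendsto
  have hmem := Θ.open_target.eventually_mem hΘp
  have hK : SmoothNear (fun y => H (Θ.symm y)) (Θ p) :=
    SmoothNear.comp (by simpa only [Θ.left_inv hp] using h.smooth_H) (hmem.mono hΘs)
  obtain ⟨k, hk, hkH⟩ := exists_contDiff_eventuallyEq_of_fderiv_single_eq_zero hK (by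
    have hdiff := (smoothNear_coordMap h.smoothNear_coord).eventually_differentiableAt
    filter_upwards [hmem, hsymm.eventually hdiff, hsymm.eventually h.smooth_H,
      hsymm.eventually h.fderiv_H, hsymm.eventually h.eventually_fderiv_coordMap_apply]
      with y hy hΘy hHy hHd hcoord
    refine fderiv_comp_symm_apply_eq_zero hy (hΘ ▸ hΘy)
      ((hΘs y hy).differentiableAt (by simp)) (hHy.differentiableAt (by simp)) fun a ha => ?_
    rw [hΘ] at ha
    have hcomp (i) : fderiv ℝ (![u, v, F, G] i) (Θ.symm y) a =
        (EuclideanSpace.single 1 1 : E4) i := by rw [← hcoord, ha]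
    exact hHd a (by simpa using hcomp 0) (by simpa using hcomp 2) (by simpa using hcomp 3))
  refine ⟨k, hk, ?_⟩
  filter_upwards [(Θ.continuousAt hp).eventually hkH, Θ.open_source.mem_nhds hp] with x hkx hx
  rw [Θ.left_inv hx, hΘ] at hkx
  exact hkx

theorem exists_isKundtChart : ∃ H₀ : ℝ → (Fin 2 → ℝ) → ℝ,
    ContDiff ℝ ∞ (fun z : ℝ × (Fin 2 → ℝ) => H₀ z.1 z.2) ∧
      ∃ Θ, p ∈ Θ.source ∧ IsKundtChart lam q H₀ Θ := by
  obtain ⟨Θ, hΘ, hp, hsmooth, hsymm⟩ := exists_openPartialHomeomorph_coordMap (by simp)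
    h.smoothNear_coord fun a ha => h.separating a (ha 0) (ha 1) (ha 2) (ha 3)
  obtain ⟨k, hk, hkH⟩ := h.exists_profile hΘ hp hsymm
  have hmetric := h.eventually_fderiv_coordMap_apply.and (hkH.and h.metric_eq)
  refine ⟨fun t y => 2 * Real.exp (y 0) * k (t, y), by fun_prop, Θ.restr _,
    ⟨hp, mem_interior_iff_mem_nhds.2 hmetric⟩, fun x hx => hΘ ▸ hsmooth x hx.1,
    fun y hy => hsymm y hy.1, fun x hx a b => ?_⟩
  obtain ⟨hcoord, hkx, hq⟩ := interior_subset hx.2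
  rw [hq a b, kundtMetric_coord, Θ.restr_apply, hΘ]
  simp only [hcoord, coordMap_apply, Matrix.cons_val]
  rw [hkx]
  ring

end IsSiklosSystem

end KundtChart

/-! ### Spinor bilinears -/

section Bilinears

/-- The squared norm of a spinor. -/
def normSq : QuadraticForm ℝ (Fin 4 → ℝ) := (1 : Matrix (Fin 4) (Fin 4) ℝ).toQuadraticForm'

/-- The components `⟨s, γ₀γ_a s⟩` of the Dirac current of a spinor `s`, a null covector with time
component `-|s|²`. -/
def diracCurrent (a : Fin 4) : QuadraticForm ℝ (Fin 4 → ℝ) :=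
  (gammaMat 0 * gammaMat a).toQuadraticForm'

/-- The components of the null covector with the spatial direction of the Dirac current, but with
the opposite time orientation. -/
def oppositeCurrent (a : Fin 4) : QuadraticForm ℝ (Fin 4 → ℝ) :=
  ((-1 / 2 : ℝ) • (gammaMat a * gammaMat 0)).toQuadraticForm'

/-- The components `⟨s, γ_a s⟩` of a spacelike covector orthogonal to the Dirac current. -/
def screen (a : Fin 4) : QuadraticForm ℝ (Fin 4 → ℝ) := (gammaMat a).toQuadraticForm'

/-- The components `⟨s, γ₅γ_a s⟩`, where `γ₅ = γ₀γ₁γ₂γ₃`, of the spacelike covector that completes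
`screen` to an orthogonal basis of the screen space of the Dirac current. -/
def dualScreen (a : Fin 4) : QuadraticForm ℝ (Fin 4 → ℝ) :=
  (gammaMat 0 * gammaMat 1 * gammaMat 2 * gammaMat 3 * gammaMat a).toQuadraticForm'

theorem toQuadraticForm'_apply (A : Matrix (Fin 4) (Fin 4) ℝ) (s : Fin 4 → ℝ) :
    A.toQuadraticForm' s = ∑ i, ∑ j, s i * A i j * s j := by
  simp [Matrix.toQuadraticForm', Matrix.toLinearMap₂'_apply, mul_assoc, mul_comm (A _ _)]

theorem normSq_apply (s : Fin 4 → ℝ) : normSq s = s 0 ^ 2 + s 1 ^ 2 + s 2 ^ 2 + s 3 ^ 2 := by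
  simp [normSq, toQuadraticForm'_apply, Fin.sum_univ_four, Matrix.one_apply]
  ring

theorem normSq_pos {s : Fin 4 → ℝ} (hs : s ≠ 0) : 0 < normSq s :=
  Matrix.PosDef.one.toQuadraticForm' s hs

theorem diracCurrent_apply (s : Fin 4 → ℝ) (a : Fin 4) : diracCurrent a s =
    ![-(s 0 ^ 2 + s 1 ^ 2 + s 2 ^ 2 + s 3 ^ 2), 2 * (s 0 * s 3 - s 1 * s 2),
      s 0 ^ 2 - s 1 ^ 2 + s 2 ^ 2 - s 3 ^ 2, -2 * (s 0 * s 1 + s 2 * s 3)] a := by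
  fin_cases a <;>
    simp [diracCurrent, toQuadraticForm'_apply, gammaMat, Fin.sum_univ_four] <;> ring

theorem oppositeCurrent_apply (s : Fin 4 → ℝ) (a : Fin 4) : oppositeCurrent a s =
    ![(s 0 ^ 2 + s 1 ^ 2 + s 2 ^ 2 + s 3 ^ 2) / 2, s 0 * s 3 - s 1 * s 2,
      (s 0 ^ 2 - s 1 ^ 2 + s 2 ^ 2 - s 3 ^ 2) / 2, -(s 0 * s 1 + s 2 * s 3)] a := by
  fin_cases a <;>
    simp [oppositeCurrent, toQuadraticForm'_apply, gammaMat, Fin.sum_univ_four] <;> ring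

theorem screen_apply (s : Fin 4 → ℝ) (a : Fin 4) : screen a s =
    ![0, 2 * (s 0 * s 2 + s 1 * s 3), 2 * (s 0 * s 1 - s 2 * s 3),
      s 0 ^ 2 - s 1 ^ 2 - s 2 ^ 2 + s 3 ^ 2] a := by
  fin_cases a <;> simp [screen, toQuadraticForm'_apply, gammaMat, Fin.sum_univ_four] <;> ring

theorem dualScreen_apply (s : Fin 4 → ℝ) (a : Fin 4) : dualScreen a s =
    ![0, s 0 ^ 2 + s 1 ^ 2 - s 2 ^ 2 - s 3 ^ 2, -2 * (s 0 * s 3 + s 1 * s 2),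
      2 * (s 1 * s 3 - s 0 * s 2)] a := by
  fin_cases a <;>
    simp [dualScreen, toQuadraticForm'_apply, gammaMat, Fin.sum_univ_four] <;> ring

/-- The value at `t` of the covector whose components are the bilinears `Q` of the spinor `s`. -/
def bilinear (Q : Fin 4 → QuadraticForm ℝ (Fin 4 → ℝ)) (s t : Fin 4 → ℝ) : ℝ := ∑ a, Q a s * t a

theorem minkowski_eq_bilinear (s t t' : Fin 4 → ℝ) :
    normSq s ^ 2 * ∑ a, eta a * (t a * t' a) =
      bilinear diracCurrent s t * bilinear oppositeCurrent s t'
        + bilinear oppositeCurrent s t * bilinear diracCurrent s t'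
        + bilinear screen s t * bilinear screen s t'
        + bilinear dualScreen s t * bilinear dualScreen s t' := by
  simp [bilinear, normSq_apply, diracCurrent_apply, screen_apply, oppositeCurrent_apply,
    dualScreen_apply, Fin.sum_univ_four, eta]
  ring

/-- The derivative of a Killing spinor `s` in a frame, in a direction with components `t`, where
`w` are the components of the Levi-Civita connection. -/
def killingDeriv (lam : ℝ) (t : Fin 4 → ℝ) (w : Fin 4 → Fin 4 → ℝ) (s : Fin 4 → ℝ) : Fin 4 → ℝ :=
  (lam / 2) • (gamma t).mulVec s -
    ((1 / 4 : ℝ) • ∑ a, ∑ b, (w a b * eta a * eta b) • (gammaMat a * gammaMat b)).mulVec s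

theorem apply_self_eq_zero_of_antisymm {ι : Type*} {w : ι → ι → ℝ} (hw : ∀ a b, w a b = -w b a)
    (a : ι) : w a a = 0 := by
  linarith [hw a a]

theorem killingDeriv_eq (lam : ℝ) (t : Fin 4 → ℝ) {w : Fin 4 → Fin 4 → ℝ}
    (hw : ∀ a b, w a b = -w b a) (s : Fin 4 → ℝ) : killingDeriv lam t w s =
    ![1 / 2 * (lam * (t 3 * s 0 + t 0 * s 1 + t 2 * s 1 + t 1 * s 2) + s 0 * w 0 2 - s 1 * w 0 3
        + s 1 * w 2 3 + s 2 * w 1 3 + s 3 * w 0 1 + s 3 * w 1 2),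
      1 / 2 * (lam * (-t 0 * s 0 + t 2 * s 0 - t 3 * s 1 + t 1 * s 3) - s 0 * w 0 3 - s 0 * w 2 3
        - s 1 * w 0 2 - s 3 * w 1 3 - s 2 * w 0 1 + s 2 * w 1 2),
      1 / 2 * (lam * (t 1 * s 0 - t 3 * s 2 - t 0 * s 3 - t 2 * s 3) - s 0 * w 1 3 + s 2 * w 0 2
        - s 3 * w 0 3 + s 3 * w 2 3 - s 1 * w 0 1 - s 1 * w 1 2),
      1 / 2 * (lam * (t 1 * s 1 + t 0 * s 2 - t 2 * s 2 + t 3 * s 3) + s 1 * w 1 3 - s 2 * w 0 3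
        - s 2 * w 2 3 - s 3 * w 0 2 + s 0 * w 0 1 - s 0 * w 1 2)] := by
  ext i
  fin_cases i <;>
    simp [killingDeriv, gamma, Fintype.linearCombination_apply, gammaMat, eta, Fin.sum_univ_four,
      dotProduct, apply_self_eq_zero_of_antisymm hw, hw 1 0, hw 2 0, hw 3 0, hw 2 1, hw 3 1,
      hw 3 2] <;>
    ring

/-- `|s| ^ (2k + 2)` times the components of the covariant derivative of `|s| ^ (-2k) Q(s)`, when
the spinor `s` has derivative `d` and the connection has components `w`. -/
def bilinearDeriv (k : ℕ) (Q : Fin 4 → QuadraticForm ℝ (Fin 4 → ℝ)) (s d : Fin 4 → ℝ)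
    (w : Fin 4 → Fin 4 → ℝ) (b : Fin 4) : ℝ :=
  normSq s * (QuadraticMap.polar (Q b) s d - ∑ a, Q a s * eta a * w a b)
    - k * Q b s * QuadraticMap.polar normSq s d

section Killing

variable (lam : ℝ) (s t : Fin 4 → ℝ) {w : Fin 4 → Fin 4 → ℝ}

theorem bilinearDeriv_diracCurrent (hw : ∀ a b, w a b = -w b a) (b : Fin 4) :
    bilinearDeriv 0 diracCurrent s (killingDeriv lam t w s) w b =
      lam * (bilinear screen s t * diracCurrent b s - bilinear diracCurrent s t * screen b s) := by
  simp only [bilinearDeriv, bilinear, QuadraticMap.polar, killingDeriv_eq lam t hw, normSq_apply,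
    diracCurrent_apply, screen_apply, Fin.sum_univ_four, eta]
  fin_cases b <;>
    simp [apply_self_eq_zero_of_antisymm hw, hw 1 0, hw 2 0, hw 3 0, hw 2 1, hw 3 1, hw 3 2] <;>
    ring

theorem bilinearDeriv_screen (hw : ∀ a b, w a b = -w b a) (b : Fin 4) :
    bilinearDeriv 1 screen s (killingDeriv lam t w s) w b =
      (lam / 2 * bilinear diracCurrent s t - bilinear screen s (w 0)) * diracCurrent b s
        + lam * (bilinear diracCurrent s t * oppositeCurrent b s
          + bilinear dualScreen s t * dualScreen b s) := by
  simp only [bilinearDeriv, bilinear, QuadraticMap.polar, killingDeriv_eq lam t hw, normSq_apply,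
    diracCurrent_apply, screen_apply, oppositeCurrent_apply, dualScreen_apply, Fin.sum_univ_four,
    eta]
  fin_cases b <;>
    simp [apply_self_eq_zero_of_antisymm hw, hw 1 0, hw 2 0, hw 3 0, hw 2 1, hw 3 1, hw 3 2] <;>
    ring

theorem bilinearDeriv_dualScreen (hw : ∀ a b, w a b = -w b a) (b : Fin 4) :
    bilinearDeriv 1 dualScreen s (killingDeriv lam t w s) w b =
      -bilinear dualScreen s (w 0) * diracCurrent b s
        - lam * (bilinear dualScreen s t * screen b s) := by
  simp only [bilinearDeriv, bilinear, QuadraticMap.polar, killingDeriv_eq lam t hw, normSq_apply,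
    diracCurrent_apply, screen_apply, dualScreen_apply, Fin.sum_univ_four, eta]
  fin_cases b <;>
    simp [apply_self_eq_zero_of_antisymm hw, hw 1 0, hw 2 0, hw 3 0, hw 2 1, hw 3 1, hw 3 2] <;>
    ring

theorem bilinearDeriv_oppositeCurrent (hw : ∀ a b, w a b = -w b a) (b : Fin 4) :
    bilinearDeriv 2 oppositeCurrent s (killingDeriv lam t w s) w b =
      -(lam / 2 * bilinear diracCurrent s t - bilinear screen s (w 0)) * screen b s
        + bilinear dualScreen s (w 0) * dualScreen b s
        - lam * (bilinear screen s t * oppositeCurrent b s) := by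
  simp only [bilinearDeriv, bilinear, QuadraticMap.polar, killingDeriv_eq lam t hw, normSq_apply,
    diracCurrent_apply, screen_apply, oppositeCurrent_apply, dualScreen_apply, Fin.sum_univ_four,
    eta]
  fin_cases b <;>
    simp [apply_self_eq_zero_of_antisymm hw, hw 1 0, hw 2 0, hw 3 0, hw 2 1, hw 3 1, hw 3 2] <;>
    ring

end Killing

end Bilinears

/-! ### The null coframe of a Killing spinor -/

section FrameForm

variable {E ι : Type*} [NormedAddCommGroup E] [NormedSpace ℝ E] [Fintype ι]

/-- The one-form with components `c` in the coframe `θ`. -/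
def frameForm (θ : ι → E → E →L[ℝ] ℝ) (c : ι → E → ℝ) (x : E) : E →L[ℝ] ℝ := ∑ a, c a x • θ a x

theorem frameForm_apply (θ : ι → E → E →L[ℝ] ℝ) (c : ι → E → ℝ) (x v : E) :
    frameForm θ c x v = ∑ a, c a x * θ a x v := by
  simp [frameForm]

theorem SmoothNear.frameForm {θ : ι → E → E →L[ℝ] ℝ} {c : ι → E → ℝ} {p : E}
    (hθ : ∀ a, SmoothNear (θ a) p) (hc : ∀ a, SmoothNear (c a) p) :
    SmoothNear (frameForm θ c) p := by
  filter_upwards [eventually_all.2 fun a => (hc a).smul (hθ a)] with x hx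
  exact ContDiffAt.sum fun a _ => hx a

theorem extD_frameForm {θ : ι → E → E →L[ℝ] ℝ} {c : ι → E → ℝ} {x : E}
    (hθ : ∀ a, DifferentiableAt ℝ (θ a) x) (hc : ∀ a, DifferentiableAt ℝ (c a) x) (v v' : E) :
    extD (frameForm θ c) x v v' =
      ∑ a, (wedge (fderiv ℝ (c a) x) (θ a x) v v' + c a x * extD (θ a) x v v') := by
  have hsum : fderiv ℝ (frameForm θ c) x = ∑ a, fderiv ℝ (fun y => c a y • θ a y) x :=
    fderiv_fun_sum fun a _ => (hc a).fun_smul (hθ a)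
  simp_rw [← extD_smul (hc _) (hθ _)]
  simp only [extD, hsum, sum_apply, Finset.sum_sub_distrib]

end FrameForm

section QuadraticForm

variable {E V : Type*} [NormedAddCommGroup E] [NormedSpace ℝ E] [NormedAddCommGroup V]
  [NormedSpace ℝ V] [FiniteDimensional ℝ V]

theorem hasFDerivAt_quadraticForm (Q : QuadraticForm ℝ V) (a : V) :
    HasFDerivAt Q (Q.polarBilin a).toContinuousLinearMap a := by
  have hB := (QuadraticMap.associated Q).toContinuousBilinearMap.hasFDerivAt_of_bilinear
    (hasFDerivAt_id a) (hasFDerivAt_id a)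
  refine (hB.congr_of_eventuallyEq (.of_forall fun b =>
    (QuadraticMap.associated_eq_self_apply ℝ Q b).symm)).congr_fderiv ?_
  ext d
  have hpolar : 2 • QuadraticMap.associated Q a d = QuadraticMap.polar Q a d :=
    congrArg (fun B => B a d) (QuadraticMap.two_nsmul_associated ℝ Q)
  have hsymm : QuadraticMap.associated Q d a = QuadraticMap.associated Q a d :=
    QuadraticMap.associated_isSymm ℝ Q d a
  rw [two_nsmul] at hpolar
  simp [hpolar, hsymm]

theorem contDiff_quadraticForm (Q : QuadraticForm ℝ V) : ContDiff ℝ ∞ Q := by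
  have hQ : Q = fun a => (QuadraticMap.associated Q).toContinuousBilinearMap a a :=
    funext fun a => (QuadraticMap.associated_eq_self_apply ℝ Q a).symm
  rw [hQ]
  fun_prop

theorem fderiv_quadraticForm_comp (Q : QuadraticForm ℝ V) {s : E → V} {x : E}
    (hs : DifferentiableAt ℝ s x) (v : E) :
    fderiv ℝ (fun y => Q (s y)) x v = QuadraticMap.polar Q (s x) (fderiv ℝ s x v) :=
  congrArg (fun T => T v) ((hasFDerivAt_quadraticForm Q (s x)).comp x hs.hasFDerivAt).fderiv

theorem differentiableAt_quadraticForm_comp (Q : QuadraticForm ℝ V) {s : E → V} {x : E}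
    (hs : DifferentiableAt ℝ s x) : DifferentiableAt ℝ (fun y => Q (s y)) x :=
  ((hasFDerivAt_quadraticForm Q (s x)).comp x hs.hasFDerivAt).differentiableAt

theorem SmoothNear.quadraticForm {s : E → V} {p : E} (hs : SmoothNear s p)
    (Q : QuadraticForm ℝ V) : SmoothNear (fun x => Q (s x)) p :=
  (smoothNear_of_contDiff (contDiff_quadraticForm Q) _).comp hs

end QuadraticForm

theorem fderiv_inv_pow_mul {E : Type*} [NormedAddCommGroup E] [NormedSpace ℝ E] {f g : E → ℝ}
    {x : E} (hf : DifferentiableAt ℝ f x) (hg : DifferentiableAt ℝ g x) (hfx : f x ≠ 0) (k : ℕ)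
    (v : E) : fderiv ℝ (fun y => (f y ^ k)⁻¹ * g y) x v =
      (f x ^ (k + 1))⁻¹ * (f x * fderiv ℝ g x v - k * g x * fderiv ℝ f x v) := by
  have hpow := (hasDerivAt_zpow (-k) (f x) (Or.inl hfx)).comp_hasFDerivAt x hf.hasFDerivAt
  simp only [zpow_neg, zpow_natCast, Function.comp_def] at hpow
  have hval : f x ^ (-k - 1 : ℤ) = (f x ^ (k + 1))⁻¹ := by
    rw [← zpow_natCast, ← zpow_neg]
    congr 1
    push_cast
    ring
  rw [(hpow.fun_mul hg.hasFDerivAt).fderiv]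
  simp only [add_apply, smul_apply, smul_eq_mul, Int.cast_neg, Int.cast_natCast, hval]
  field_simp
  ring

section NullCoframe

variable {E : Type*} [NormedAddCommGroup E] [NormedSpace ℝ E]

/-- At `x`, the one-forms `w` are the components of a metric torsion-free connection in the coframe
`θ`, and `s` satisfies the Killing spinor equation with respect to this connection. -/
structure IsKillingFrame (lam : ℝ) (θ : Fin 4 → E → E →L[ℝ] ℝ) (w : Fin 4 → Fin 4 → E →L[ℝ] ℝ)
    (s : E → Fin 4 → ℝ) (x : E) : Prop where
  antisymm : ∀ v a b, w a b v = -w b a v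
  torsionFree : ∀ a v v', extD (θ a) x v v' = -(eta a * ∑ b, wedge (w a b) (θ b x) v v')
  killing : ∀ v, fderiv ℝ s x v = killingDeriv lam (fun a => θ a x v) (fun a b => w a b v) (s x)

/-- The one-form `|s| ^ (-2k) Q(s)`, with components in the coframe `θ`. -/
def weightedForm (θ : Fin 4 → E → E →L[ℝ] ℝ) (s : E → Fin 4 → ℝ) (k : ℕ)
    (Q : Fin 4 → QuadraticForm ℝ (Fin 4 → ℝ)) : E → E →L[ℝ] ℝ :=
  frameForm θ fun a x => (normSq (s x) ^ k)⁻¹ * Q a (s x)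

variable {lam : ℝ} {θ : Fin 4 → E → E →L[ℝ] ℝ} {w : Fin 4 → Fin 4 → E →L[ℝ] ℝ}
  {s : E → Fin 4 → ℝ} {x p : E} {k : ℕ} {Q : Fin 4 → QuadraticForm ℝ (Fin 4 → ℝ)}

theorem smoothNear_inv_normSq_pow (hs : SmoothNear s p) (hsp : s p ≠ 0) (k : ℕ) :
    SmoothNear (fun x => (normSq (s x) ^ k)⁻¹) p :=
  SmoothNear.inv ((hs.quadraticForm normSq).mono fun _ hx => hx.pow k)
    (pow_pos (normSq_pos hsp) k).ne'

theorem smoothNear_weightedForm (hθ : ∀ a, SmoothNear (θ a) p) (hs : SmoothNear s p)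
    (hsp : s p ≠ 0) : SmoothNear (weightedForm θ s k Q) p :=
  .frameForm hθ fun a => (smoothNear_inv_normSq_pow hs hsp k).mul (hs.quadraticForm (Q a))

theorem bilinear_eq_mul_weightedForm (hs : s x ≠ 0) (k : ℕ)
    (Q : Fin 4 → QuadraticForm ℝ (Fin 4 → ℝ)) (v : E) :
    bilinear Q (s x) (fun a => θ a x v) = normSq (s x) ^ k * weightedForm θ s k Q x v := by
  have hN := (pow_pos (normSq_pos hs) k).ne'
  simp only [weightedForm, frameForm_apply, mul_assoc, ← Finset.mul_sum, mul_inv_cancel_left₀ hN,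
    bilinear]

theorem IsKillingFrame.extD_weightedForm (h : IsKillingFrame lam θ w s x)
    (hθ : ∀ a, DifferentiableAt ℝ (θ a) x) (hs : DifferentiableAt ℝ s x) (hsx : s x ≠ 0) (k : ℕ)
    (Q : Fin 4 → QuadraticForm ℝ (Fin 4 → ℝ)) (v v' : E) :
    normSq (s x) ^ (k + 1) * extD (weightedForm θ s k Q) x v v' =
      ∑ b, (bilinearDeriv k Q (s x) (fderiv ℝ s x v) (fun a b => w a b v) b * θ b x v'
        - bilinearDeriv k Q (s x) (fderiv ℝ s x v') (fun a b => w a b v') b * θ b x v) := by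
  have hN := differentiableAt_quadraticForm_comp normSq hs
  have hQ a := differentiableAt_quadraticForm_comp (Q a) hs
  have hN0 : normSq (s x) ≠ 0 := (normSq_pos hsx).ne'
  have hc a : DifferentiableAt ℝ (fun y => (normSq (s y) ^ k)⁻¹ * Q a (s y)) x :=
    ((hN.pow k).inv (pow_ne_zero k hN0)).mul (hQ a)
  rw [weightedForm, extD_frameForm hθ hc, Finset.mul_sum]
  simp only [wedge, fderiv_inv_pow_mul hN (hQ _) hN0, fderiv_quadraticForm_comp _ hs,
    h.torsionFree, bilinearDeriv, Fin.sum_univ_four]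
  field_simp
  ring

/-- The one-form dual to the Dirac current. -/
def currentForm (θ : Fin 4 → E → E →L[ℝ] ℝ) (s : E → Fin 4 → ℝ) : E → E →L[ℝ] ℝ :=
  weightedForm θ s 0 diracCurrent

/-- The unit one-form in the direction of `screen`. -/
def screenForm (θ : Fin 4 → E → E →L[ℝ] ℝ) (s : E → Fin 4 → ℝ) : E → E →L[ℝ] ℝ :=
  weightedForm θ s 1 screen

/-- The unit one-form in the direction of `dualScreen`. -/
def dualScreenForm (θ : Fin 4 → E → E →L[ℝ] ℝ) (s : E → Fin 4 → ℝ) : E → E →L[ℝ] ℝ :=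
  weightedForm θ s 1 dualScreen

/-- The null one-form orthogonal to `screenForm` and `dualScreenForm` whose scalar product with
`currentForm` is `1`. -/
def oppositeForm (θ : Fin 4 → E → E →L[ℝ] ℝ) (s : E → Fin 4 → ℝ) : E → E →L[ℝ] ℝ :=
  weightedForm θ s 2 oppositeCurrent

/-- The coefficient of `currentForm` in the covariant derivative of `screenForm`. -/
def screenConnection (lam : ℝ) (θ : Fin 4 → E → E →L[ℝ] ℝ) (w : Fin 4 → Fin 4 → E →L[ℝ] ℝ)
    (s : E → Fin 4 → ℝ) (x : E) : E →L[ℝ] ℝ :=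
  (normSq (s x) ^ 2)⁻¹ • ((lam / 2) • currentForm θ s x - ∑ a, screen a (s x) • w 0 a)

/-- The coefficient of `currentForm` in the covariant derivative of `dualScreenForm`. -/
def dualScreenConnection (w : Fin 4 → Fin 4 → E →L[ℝ] ℝ) (s : E → Fin 4 → ℝ) (x : E) :
    E →L[ℝ] ℝ :=
  -((normSq (s x) ^ 2)⁻¹ • ∑ a, dualScreen a (s x) • w 0 a)

theorem currentForm_ne_zero {t : E} (ht : ∀ a, θ a x t = (Pi.single 0 1 : Fin 4 → ℝ) a)
    (hsx : s x ≠ 0) : currentForm θ s x ≠ 0 := by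
  intro h
  have hcurrent : currentForm θ s x t = -normSq (s x) := by
    simp [currentForm, weightedForm, frameForm_apply, ht, Fin.sum_univ_four, diracCurrent_apply,
      normSq_apply]
  rw [h] at hcurrent
  exact (normSq_pos hsx).ne' (by simpa using hcurrent.symm)

theorem bilinear_diracCurrent_eq (θ : Fin 4 → E → E →L[ℝ] ℝ) (s : E → Fin 4 → ℝ) (x v : E) :
    bilinear diracCurrent (s x) (fun a => θ a x v) = currentForm θ s x v := by
  simp [currentForm, weightedForm, frameForm_apply, bilinear]

theorem bilinear_screen_eq (hsx : s x ≠ 0) (v : E) :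
    bilinear screen (s x) (fun a => θ a x v) = normSq (s x) * screenForm θ s x v := by
  rw [bilinear_eq_mul_weightedForm hsx 1, pow_one, screenForm]

theorem bilinear_dualScreen_eq (hsx : s x ≠ 0) (v : E) :
    bilinear dualScreen (s x) (fun a => θ a x v) = normSq (s x) * dualScreenForm θ s x v := by
  rw [bilinear_eq_mul_weightedForm hsx 1, pow_one, dualScreenForm]

theorem bilinear_oppositeCurrent_eq (hsx : s x ≠ 0) (v : E) :
    bilinear oppositeCurrent (s x) (fun a => θ a x v) = normSq (s x) ^ 2 * oppositeForm θ s x v :=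
  bilinear_eq_mul_weightedForm hsx 2 oppositeCurrent v

theorem normSq_sq_mul_screenConnection (hsx : s x ≠ 0) (v : E) :
    normSq (s x) ^ 2 * screenConnection lam θ w s x v =
      lam / 2 * currentForm θ s x v - bilinear screen (s x) (fun a => w 0 a v) := by
  simp [screenConnection, bilinear, (normSq_pos hsx).ne']

theorem bilinear_dualScreen_connection (hsx : s x ≠ 0) (v : E) :
    bilinear dualScreen (s x) (fun a => w 0 a v) =
      -(normSq (s x) ^ 2 * dualScreenConnection w s x v) := by
  simp [dualScreenConnection, bilinear, (normSq_pos hsx).ne']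

theorem minkowski_eq_nullForms (hsx : s x ≠ 0) (v v' : E) :
    ∑ a, eta a * (θ a x v * θ a x v') =
      currentForm θ s x v * oppositeForm θ s x v' + oppositeForm θ s x v * currentForm θ s x v'
        + screenForm θ s x v * screenForm θ s x v'
        + dualScreenForm θ s x v * dualScreenForm θ s x v' := by
  refine mul_left_cancel₀ (pow_ne_zero 2 (normSq_pos hsx).ne') ?_
  rw [minkowski_eq_bilinear]
  simp only [bilinear_diracCurrent_eq, bilinear_screen_eq hsx, bilinear_dualScreen_eq hsx,
    bilinear_oppositeCurrent_eq hsx]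
  ring

theorem sum_mul_eq_bilinear (Q : Fin 4 → QuadraticForm ℝ (Fin 4 → ℝ)) (v : E) :
    ∑ b, Q b (s x) * θ b x v = bilinear Q (s x) fun a => θ a x v :=
  rfl

namespace IsKillingFrame

variable (h : IsKillingFrame lam θ w s x) (hθ : ∀ a, DifferentiableAt ℝ (θ a) x)
  (hs : DifferentiableAt ℝ s x) (hsx : s x ≠ 0)

include h hθ hs hsx

theorem extD_currentForm (v v' : E) :
    extD (currentForm θ s) x v v' =
      2 * lam * wedge (screenForm θ s x) (currentForm θ s x) v v' := by
  refine mul_left_cancel₀ (pow_ne_zero 1 (normSq_pos hsx).ne') ?_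
  rw [currentForm, h.extD_weightedForm hθ hs hsx 0, ← currentForm]
  simp only [h.killing, bilinearDeriv_diracCurrent lam _ _ (h.antisymm _), sub_mul, mul_sub,
    mul_assoc, Finset.sum_sub_distrib, ← Finset.mul_sum, sum_mul_eq_bilinear,
    bilinear_diracCurrent_eq, bilinear_screen_eq hsx, wedge]
  ring

theorem extD_screenForm (v v' : E) :
    extD (screenForm θ s) x v v' =
      wedge (screenConnection lam θ w s x - lam • oppositeForm θ s x) (currentForm θ s x) v v' := by
  have hα := normSq_sq_mul_screenConnection (lam := lam) (θ := θ) (w := w) hsx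
  refine mul_left_cancel₀ (pow_ne_zero 2 (normSq_pos hsx).ne') ?_
  rw [screenForm, h.extD_weightedForm hθ hs hsx 1]
  simp only [h.killing, bilinearDeriv_screen lam _ _ (h.antisymm _), bilinear_diracCurrent_eq,
    ← hα, add_mul, mul_add, mul_assoc, Finset.sum_sub_distrib, Finset.sum_add_distrib,
    ← Finset.mul_sum, sum_mul_eq_bilinear, bilinear_dualScreen_eq hsx,
    bilinear_oppositeCurrent_eq hsx, wedge, sub_apply, smul_apply, smul_eq_mul]
  ring

theorem extD_dualScreenForm (v v' : E) :
    extD (dualScreenForm θ s) x v v' =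
      lam * wedge (screenForm θ s x) (dualScreenForm θ s x) v v'
        + wedge (dualScreenConnection w s x) (currentForm θ s x) v v' := by
  refine mul_left_cancel₀ (pow_ne_zero 2 (normSq_pos hsx).ne') ?_
  rw [dualScreenForm, h.extD_weightedForm hθ hs hsx 1, ← dualScreenForm]
  simp only [h.killing, bilinearDeriv_dualScreen lam _ _ (h.antisymm _),
    bilinear_dualScreen_connection hsx, sub_mul, mul_assoc, Finset.sum_sub_distrib,
    ← Finset.mul_sum, sum_mul_eq_bilinear, bilinear_diracCurrent_eq, bilinear_screen_eq hsx,
    bilinear_dualScreen_eq hsx, wedge]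
  ring

theorem extD_oppositeForm (v v' : E) :
    extD (oppositeForm θ s) x v v' =
      -wedge (screenConnection lam θ w s x - lam • oppositeForm θ s x) (screenForm θ s x) v v'
        - wedge (dualScreenConnection w s x) (dualScreenForm θ s x) v v' := by
  have hα := normSq_sq_mul_screenConnection (lam := lam) (θ := θ) (w := w) hsx
  refine mul_left_cancel₀ (pow_ne_zero 3 (normSq_pos hsx).ne') ?_
  rw [oppositeForm, h.extD_weightedForm hθ hs hsx 2, ← oppositeForm]
  simp only [h.killing, bilinearDeriv_oppositeCurrent lam _ _ (h.antisymm _),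
    bilinear_diracCurrent_eq, ← hα, bilinear_dualScreen_connection hsx, sub_mul, add_mul,
    neg_mul, mul_assoc, Finset.sum_sub_distrib, Finset.sum_add_distrib, Finset.sum_neg_distrib,
    ← Finset.mul_sum, sum_mul_eq_bilinear, bilinear_screen_eq hsx, bilinear_dualScreen_eq hsx,
    bilinear_oppositeCurrent_eq hsx, wedge, sub_apply, smul_apply, smul_eq_mul]
  ring

theorem adaptedCoframe :
    AdaptedCoframe lam (currentForm θ s) (screenForm θ s) (dualScreenForm θ s) (oppositeForm θ s)
      (screenConnection lam θ w s x - lam • oppositeForm θ s x) (dualScreenConnection w s x) x :=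
  ⟨h.extD_currentForm hθ hs hsx, h.extD_screenForm hθ hs hsx, h.extD_dualScreenForm hθ hs hsx,
    h.extD_oppositeForm hθ hs hsx⟩

end IsKillingFrame

theorem eq_zero_of_nullForms_eq_zero (hsx : s x ≠ 0)
    (hinj : ∀ v, (∀ a, θ a x v = 0) → v = 0) (hsurj : ∀ t : Fin 4 → ℝ, ∃ v, ∀ a, θ a x v = t a)
    {v : E} (hκ : currentForm θ s x v = 0) (hl : screenForm θ s x v = 0)
    (hm : dualScreenForm θ s x v = 0) (hn : oppositeForm θ s x v = 0) : v = 0 := by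
  refine hinj v fun a => ?_
  obtain ⟨e, he⟩ := hsurj (Pi.single a 1)
  have horth : ∑ b, eta b * (θ b x v * θ b x e) = 0 := by
    rw [minkowski_eq_nullForms hsx, hκ, hl, hm, hn]
    ring
  have heta : eta a ≠ 0 := by
    unfold eta
    split_ifs <;> norm_num
  simpa [he, Pi.single_apply, heta] using horth

end NullCoframe

theorem exists_isKundtChart_of_isKillingFrame {lam : ℝ} {θ : Fin 4 → E4 → E4 →L[ℝ] ℝ}
    {s : E4 → Fin 4 → ℝ} {p : E4} (hlam : lam ≠ 0) (hθ : ∀ a, SmoothNear (θ a) p)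
    (hs : SmoothNear s p) (hsp : s p ≠ 0) (hinj : ∀ v, (∀ a, θ a p v = 0) → v = 0)
    (hsurj : ∀ t : Fin 4 → ℝ, ∃ v, ∀ a, θ a p v = t a)
    (hK : ∀ᶠ x in 𝓝 p, ∃ w, IsKillingFrame lam θ w s x) :
    ∃ H₀ : ℝ → (Fin 2 → ℝ) → ℝ, ContDiff ℝ ∞ (fun z : ℝ × (Fin 2 → ℝ) => H₀ z.1 z.2) ∧
      ∃ Θ, p ∈ Θ.source ∧
        IsKundtChart lam (fun x v v' => ∑ a, eta a * (θ a x v * θ a x v')) H₀ Θ := by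
  have hs0 : ∀ᶠ x in 𝓝 p, s x ≠ 0 := hs.continuousAt.eventually_ne hsp
  obtain ⟨e, he⟩ := hsurj (Pi.single 0 1)
  have hE : ∀ᶠ x in 𝓝 p, ∃ α β, AdaptedCoframe lam (currentForm θ s) (screenForm θ s)
      (dualScreenForm θ s) (oppositeForm θ s) α β x := by
    filter_upwards [eventually_all.2 fun a => (hθ a).eventually_differentiableAt,
      hs.eventually_differentiableAt, hs0, hK] with x hθx hsx hx0 ⟨w, hw⟩
    exact ⟨_, _, hw.adaptedCoframe hθx hsx hx0⟩
  obtain ⟨u, v, F, G, H, hsystem⟩ := exists_isSiklosSystem hlam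
    (smoothNear_weightedForm hθ hs hsp) (smoothNear_weightedForm hθ hs hsp)
    (smoothNear_weightedForm hθ hs hsp) (smoothNear_weightedForm hθ hs hsp)
    (currentForm_ne_zero he hsp)
    (fun _ => eq_zero_of_nullForms_eq_zero hsp hinj hsurj) hE
  refine (hsystem.congr_metric ?_).exists_isKundtChart
  filter_upwards [hs0] with x hx a b
  exact minkowski_eq_nullForms hx a b

/-! ### The Levi-Civita connection of an orthonormal frame -/

section MovingFrame

variable {E : Type*} [NormedAddCommGroup E] [NormedSpace ℝ E]

section Coframe

variable {ι : Type*} [Fintype ι] (e : ι → E → E)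

/-- The map that sends a tuple of components to the vector with these components in the frame `e`
at a point. -/
def frameMap (y : E) : (ι → ℝ) →L[ℝ] E :=
  ∑ a, (ContinuousLinearMap.proj a : (ι → ℝ) →L[ℝ] ℝ).smulRight (e a y)

/-- The coframe dual to the frame `e`, zero at the points where `e` is not a basis. -/
def coframe (a : ι) (y : E) : E →L[ℝ] ℝ :=
  (ContinuousLinearMap.proj a : (ι → ℝ) →L[ℝ] ℝ).comp (frameMap e y).inverse

variable {e}

theorem frameMap_apply (y : E) (c : ι → ℝ) : frameMap e y c = ∑ a, c a • e a y := by
  simp [frameMap, sum_apply]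

theorem sum_coframe_smul {y : E} (h : (frameMap e y).IsInvertible) (v : E) :
    ∑ a, coframe e a y v • e a y = v :=
  (frameMap_apply y _).symm.trans (h.self_apply_inverse v)

theorem coframe_apply_frameMap {y : E} (h : (frameMap e y).IsInvertible) (a : ι) (c : ι → ℝ) :
    coframe e a y (frameMap e y c) = c a := by
  rw [coframe, ContinuousLinearMap.comp_apply, h.inverse_apply_self]
  rfl

theorem coframe_apply_frame [DecidableEq ι] {y : E} (h : (frameMap e y).IsInvertible) (a b : ι) :
    coframe e a y (e b y) = if a = b then 1 else 0 := by
  have hb : frameMap e y (Pi.single b 1) = e b y := by simp [frameMap_apply, Pi.single_apply]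
  rw [← hb, coframe_apply_frameMap h, Pi.single_apply]

theorem smoothNear_coframe {p : E} (he : ∀ a, SmoothNear (e a) p)
    (h : ∀ᶠ y in 𝓝 p, (frameMap e y).IsInvertible) (a : ι) : SmoothNear (coframe e a) p := by
  filter_upwards [eventually_all.2 he, h] with y hy hi
  have hmap : ContDiffAt ℝ ∞ (frameMap e) y :=
    ContDiffAt.sum fun a _ => contDiffAt_const.smulRight (hy a)
  exact contDiffAt_const.clm_comp (hi.contDiffAt_map_inverse.comp y hmap)

theorem fderiv_coframe_apply_frame {y : E} (he : ∀ a, DifferentiableAt ℝ (e a) y)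
    (hθ : ∀ a, DifferentiableAt ℝ (coframe e a) y)
    (h : ∀ᶠ z in 𝓝 y, (frameMap e z).IsInvertible) (a b : ι) (v : E) :
    fderiv ℝ (coframe e a) y v (e b y) = -coframe e a y (fderiv ℝ (e b) y v) := by
  classical
  have hconst : (fun z => coframe e a z (e b z)) =ᶠ[𝓝 y] fun _ => if a = b then 1 else 0 :=
    h.mono fun z hz => coframe_apply_frame hz a b
  have hzero : fderiv ℝ (fun z => coframe e a z (e b z)) y v = 0 := by simp [hconst.fderiv_eq]
  rw [fderiv_clm_apply (hθ a) (he b)] at hzero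
  exact eq_neg_of_add_eq_zero_right hzero

theorem extD_coframe_frame {y : E} (he : ∀ a, DifferentiableAt ℝ (e a) y)
    (hθ : ∀ a, DifferentiableAt ℝ (coframe e a) y)
    (h : ∀ᶠ z in 𝓝 y, (frameMap e z).IsInvertible) (a c d : ι) :
    extD (coframe e a) y (e c y) (e d y) =
      -coframe e a y (VectorField.lieBracket ℝ (e c) (e d) y) := by
  rw [extD, fderiv_coframe_apply_frame he hθ h, fderiv_coframe_apply_frame he hθ h,
    VectorField.lieBracket, map_sub]
  ring

theorem extD_eq_sum_coframe (κ : E → E →L[ℝ] ℝ) {y : E} (h : (frameMap e y).IsInvertible)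
    (v v' : E) : extD κ y v v' =
      ∑ c, ∑ d, coframe e c y v * coframe e d y v' * extD κ y (e c y) (e d y) := by
  have hbilin (T : E →L[ℝ] E →L[ℝ] ℝ) (a b : E) :
      T a b = ∑ c, ∑ d, coframe e c y a * coframe e d y b * T (e c y) (e d y) := by
    conv_lhs => rw [← sum_coframe_smul h a]
    refine (by simp : _ = ∑ c, coframe e c y a * T (e c y) b).trans ?_
    refine Finset.sum_congr rfl fun c _ => ?_
    conv_lhs => rw [← sum_coframe_smul h b]
    simp [Finset.mul_sum, mul_assoc]
  exact hbilin (fderiv ℝ κ y - (fderiv ℝ κ y).flip) v v'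

end Coframe

variable (e : Fin 4 → E → E)

/-- The scalar products `⟨[e_c, e_b], e_a⟩` in an orthonormal frame. -/
def structureCoeff (c b a : Fin 4) (y : E) : ℝ :=
  eta a * coframe e a y (VectorField.lieBracket ℝ (e c) (e b) y)

/-- The components of the Levi-Civita connection of an orthonormal frame. -/
def koszulCoeff (c b a : Fin 4) (y : E) : ℝ :=
  (1 / 2) * (structureCoeff e c b a y - structureCoeff e c a b y - structureCoeff e b a c y)

/-- The connection forms of an orthonormal frame. -/
def connForm (a b : Fin 4) : E → E →L[ℝ] ℝ :=
  frameForm (coframe e) fun c => koszulCoeff e c b a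

variable {e}

theorem smoothNear_structureCoeff {p : E} (he : ∀ a, SmoothNear (e a) p)
    (h : ∀ᶠ y in 𝓝 p, (frameMap e y).IsInvertible) (c b a : Fin 4) :
    SmoothNear (structureCoeff e c b a) p :=
  (smoothNear_const (eta a) p).mul ((smoothNear_coframe he h a).clm_apply
    (((he b).fderiv.clm_apply (he c)).sub ((he c).fderiv.clm_apply (he b))))

theorem smoothNear_connForm {p : E} (he : ∀ a, SmoothNear (e a) p)
    (h : ∀ᶠ y in 𝓝 p, (frameMap e y).IsInvertible) (a b : Fin 4) :
    SmoothNear (connForm e a b) p := by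
  have hs := smoothNear_structureCoeff he h
  exact .frameForm (smoothNear_coframe he h) fun c =>
    (smoothNear_const _ p).mul (((hs c b a).sub (hs c a b)).sub (hs b a c))

theorem structureCoeff_swap (c b a : Fin 4) (y : E) :
    structureCoeff e c b a y = -structureCoeff e b c a y := by
  rw [structureCoeff, structureCoeff, VectorField.lieBracket_swap, map_neg, mul_neg]

theorem koszulCoeff_antisymm (c b a : Fin 4) (y : E) :
    koszulCoeff e c b a y = -koszulCoeff e c a b y := by
  rw [koszulCoeff, koszulCoeff, structureCoeff_swap b a]
  ring

theorem koszulCoeff_sub_swap (c d a : Fin 4) (y : E) :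
    koszulCoeff e c d a y - koszulCoeff e d c a y = structureCoeff e c d a y := by
  rw [koszulCoeff, koszulCoeff, structureCoeff_swap d c a]
  ring

theorem connForm_antisymm (a b : Fin 4) (y v : E) : connForm e a b y v = -connForm e b a y v := by
  simp only [connForm, frameForm_apply, koszulCoeff_antisymm _ b a, neg_mul,
    Finset.sum_neg_distrib]

theorem eta_mul_self (a : Fin 4) : eta a * eta a = 1 := by
  unfold eta
  split_ifs <;> norm_num

theorem extD_coframe {y : E} (he : ∀ a, DifferentiableAt ℝ (e a) y)
    (hθ : ∀ a, DifferentiableAt ℝ (coframe e a) y)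
    (h : ∀ᶠ z in 𝓝 y, (frameMap e z).IsInvertible) (a : Fin 4) (v v' : E) :
    extD (coframe e a) y v v' =
      -(eta a * ∑ b, wedge (connForm e a b y) (coframe e b y) v v') := by
  have hframe c d : extD (coframe e a) y (e c y) (e d y) =
      -(eta a * (koszulCoeff e c d a y - koszulCoeff e d c a y)) := by
    rw [extD_coframe_frame he hθ h, koszulCoeff_sub_swap, structureCoeff, ← mul_assoc,
      eta_mul_self, one_mul]
  simp only [extD_eq_sum_coframe _ h.self_of_nhds v v', hframe, wedge, connForm, frameForm_apply,
    Fin.sum_univ_four]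
  ring

end MovingFrame

/-! ### Unique continuation -/

section UniqueContinuation

variable {E F : Type*} [NormedAddCommGroup E] [NormedSpace ℝ E] [NormedAddCommGroup F]
  [NormedSpace ℝ F] {s : E → F} {p : E}

theorem eventually_eq_zero_of_norm_fderiv_le {K : ℝ} (hs : ∀ᶠ y in 𝓝 p, DifferentiableAt ℝ s y)
    (hK : ∀ᶠ y in 𝓝 p, ∀ v, ‖fderiv ℝ s y v‖ ≤ K * ‖v‖ * ‖s y‖) (h0 : s p = 0) :
    ∀ᶠ y in 𝓝 p, s y = 0 := by
  obtain ⟨r, hr, hball⟩ := Metric.eventually_nhds_iff_ball.1 (hs.and hK)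
  filter_upwards [Metric.ball_mem_nhds p hr] with y hy
  have hmem t (ht : t ∈ Icc (0 : ℝ) 1) : p + t • (y - p) ∈ Metric.ball p r :=
    (convex_ball p r).add_smul_sub_mem (Metric.mem_ball_self hr) hy ht
  have hderiv t (ht : t ∈ Icc (0 : ℝ) 1) : HasDerivAt (fun t : ℝ => s (p + t • (y - p)))
      (fderiv ℝ s (p + t • (y - p)) (y - p)) t := by
    have hline : HasDerivAt (fun t : ℝ => p + t • (y - p)) (y - p) t := by
      simpa using ((hasDerivAt_id t).smul_const (y - p)).const_add p
    exact (hball _ (hmem t ht)).1.hasFDerivAt.comp_hasDerivAt t hline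
  have hend := eq_zero_of_abs_deriv_le_mul_abs_self_of_eq_zero_right
    (K := K * ‖y - p‖) (fun t ht => (hderiv t ht).continuousAt.continuousWithinAt)
    (fun t ht => (hderiv t (Ico_subset_Icc_self ht)).hasDerivWithinAt) (by simpa using h0)
    (fun t ht => (hball _ (hmem t (Ico_subset_Icc_self ht))).2 _) 1 (by simp)
  simpa using hend

theorem eventually_eq_zero_of_fderiv_eq_sum_smul {J : Type*} [Fintype J]
    {φ : J → E → E →L[ℝ] ℝ} {T : J → F →L[ℝ] F} (hφ : ∀ j, ContinuousAt (φ j) p)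
    (hs : ∀ᶠ y in 𝓝 p, DifferentiableAt ℝ s y)
    (h : ∀ᶠ y in 𝓝 p, ∀ v, fderiv ℝ s y v = ∑ j, φ j y v • T j (s y)) (h0 : s p = 0) :
    ∀ᶠ y in 𝓝 p, s y = 0 := by
  have hbound : ∀ᶠ y in 𝓝 p, ∀ j, ‖φ j y‖ < ‖φ j p‖ + 1 :=
    eventually_all.2 fun j => (hφ j).norm.eventually_lt_const (lt_add_one _)
  refine eventually_eq_zero_of_norm_fderiv_le (K := ∑ j, (‖φ j p‖ + 1) * ‖T j‖) hs ?_ h0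
  filter_upwards [h, hbound] with y hy hb v
  rw [hy, Finset.sum_mul, Finset.sum_mul]
  refine norm_sum_le_of_le _ fun j _ => ?_
  calc ‖φ j y v • T j (s y)‖ = ‖φ j y v‖ * ‖T j (s y)‖ := norm_smul _ _
    _ ≤ (‖φ j p‖ + 1) * ‖v‖ * (‖T j‖ * ‖s y‖) := by
      gcongr
      · exact (φ j y).le_of_opNorm_le (hb j).le v
      · exact (T j).le_opNorm _
    _ = (‖φ j p‖ + 1) * ‖T j‖ * ‖v‖ * ‖s y‖ := by ring

/-- The matrices multiplying the coframe and connection components in `killingDeriv`. -/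
def killingMatrix (lam : ℝ) : Fin 4 ⊕ Fin 4 × Fin 4 → Matrix (Fin 4) (Fin 4) ℝ :=
  Sum.elim (fun a => (lam / 2) • gammaMat a)
    fun ab => -(1 / 4 * (eta ab.1 * eta ab.2)) • (gammaMat ab.1 * gammaMat ab.2)

theorem killingDeriv_eq_sum_smul (lam : ℝ) (t : Fin 4 → ℝ) (w : Fin 4 → Fin 4 → ℝ)
    (s : Fin 4 → ℝ) : killingDeriv lam t w s =
      ∑ j, Sum.elim t (fun ab => w ab.1 ab.2) j • (killingMatrix lam j).mulVec s := by
  simp only [killingDeriv, gamma, Fintype.linearCombination_apply, Fintype.sum_sum_type,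
    Fintype.sum_prod_type, killingMatrix, Sum.elim_inl, Sum.elim_inr, Matrix.smul_mulVec,
    Matrix.sum_mulVec, Finset.smul_sum, smul_smul, sub_eq_add_neg, ← Finset.sum_neg_distrib,
    ← neg_smul, mul_comm (lam / 2)]
  congr! 4
  ring

theorem eventually_eq_zero_of_killing {lam : ℝ} {θ : Fin 4 → E → E →L[ℝ] ℝ}
    {w : Fin 4 → Fin 4 → E → E →L[ℝ] ℝ} {s : E → Fin 4 → ℝ}
    (hθ : ∀ a, ContinuousAt (θ a) p) (hw : ∀ a b, ContinuousAt (w a b) p)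
    (hs : ∀ᶠ y in 𝓝 p, DifferentiableAt ℝ s y)
    (hk : ∀ᶠ y in 𝓝 p, ∀ v,
      fderiv ℝ s y v = killingDeriv lam (fun a => θ a y v) (fun a b => w a b y v) (s y))
    (h0 : s p = 0) : ∀ᶠ y in 𝓝 p, s y = 0 := by
  refine eventually_eq_zero_of_fderiv_eq_sum_smul (J := Fin 4 ⊕ Fin 4 × Fin 4)
    (φ := Sum.elim θ fun ab => w ab.1 ab.2)
    (T := fun j => (killingMatrix lam j).mulVecLin.toContinuousLinearMap)
    (by rintro (a | ⟨a, b⟩); exacts [hθ a, hw a b]) hs (hk.mono fun y hy v => ?_) h0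
  rw [hy, killingDeriv_eq_sum_smul]
  refine Finset.sum_congr rfl fun j _ => ?_
  rcases j with a | ⟨a, b⟩ <;> rfl

end UniqueContinuation

/-! ### Spin structures and Killing spinors in a chart -/

theorem mlieBracket_eq_lieBracket {E : Type*} [NormedAddCommGroup E] [NormedSpace ℝ E]
    (X Y : E → E) (y : E) :
    VectorField.mlieBracket 𝓘(ℝ, E) (M := E) X Y y = VectorField.lieBracket ℝ X Y y := by
  rw [← VectorField.lieBracketWithin_univ]
  exact congrFun VectorField.mlieBracketWithin_eq_lieBracketWithin y

section FrameChart

variable {M : Type*} [TopologicalSpace M] [ChartedSpace E4 M] [IsManifold (𝓡 4) ∞ M]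
  {g : LorentzianMetric M} {ι : Type*}

/-- A smooth chart whose domain lies in the `i`-th member of the cover of a spin structure. -/
structure IsFrameChart (P : SpinStructure g ι) (i : ι) (e : OpenPartialHomeomorph M E4) :
    Prop where
  subset : e.source ⊆ P.dom i
  contMDiffOn : ContMDiffOn (𝓡 4) (𝓡 4) ∞ e e.source
  contMDiffOn_symm : ContMDiffOn (𝓡 4) (𝓡 4) ∞ e.symm e.target

theorem exists_isFrameChart (P : SpinStructure g ι) {i : ι} {p : M} (hp : p ∈ P.dom i) :
    ∃ e, IsFrameChart P i e ∧ p ∈ e.source :=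
  ⟨(chartAt E4 p).restrOpen (P.dom i) (P.isOpen_dom i),
    ⟨by simp, (contMDiffOn_chart (I := 𝓡 4)).mono (by simp),
      (contMDiffOn_chart_symm (I := 𝓡 4)).mono (by simp)⟩, by simp [hp]⟩

/-- The differential of the inverse of a chart. -/
def chartDeriv (e : OpenPartialHomeomorph M E4) (y : E4) :
    E4 →L[ℝ] TangentSpace (𝓡 4) (e.symm y) :=
  mfderiv (𝓡 4) (𝓡 4) e.symm y

/-- The `i`-th frame of a spin structure in a chart. -/
def chartFrame (P : SpinStructure g ι) (i : ι) (e : OpenPartialHomeomorph M E4) (a : Fin 4)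
    (y : E4) : E4 :=
  VectorField.mpullback (𝓡 4) (𝓡 4) e.symm (P.frame i a) y

variable {P : SpinStructure g ι} {i : ι} {e : OpenPartialHomeomorph M E4} {ε : P.Spinor} {lam : ℝ}

namespace IsFrameChart

theorem mdifferentiable (he : IsFrameChart P i e) : e.MDifferentiable (𝓡 4) (𝓡 4) :=
  ⟨he.contMDiffOn.mdifferentiableOn (by simp), he.contMDiffOn_symm.mdifferentiableOn (by simp)⟩

variable {x : M} {y : E4}

theorem isInvertible_chartDeriv (he : IsFrameChart P i e) (hy : y ∈ e.target) :
    (chartDeriv e y).IsInvertible :=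
  ⟨he.mdifferentiable.symm.mfderiv hy, rfl⟩

theorem symm_mem_dom (he : IsFrameChart P i e) (hy : y ∈ e.target) : e.symm y ∈ P.dom i :=
  he.subset (e.map_target hy)

theorem dom_mem_nhds (he : IsFrameChart P i e) (hy : y ∈ e.target) : P.dom i ∈ 𝓝 (e.symm y) :=
  (P.isOpen_dom i).mem_nhds (he.symm_mem_dom hy)

theorem contMDiffAt_symm (he : IsFrameChart P i e) (hy : y ∈ e.target) :
    ContMDiffAt (𝓡 4) (𝓡 4) ∞ e.symm y :=
  he.contMDiffOn_symm.contMDiffAt (e.open_target.mem_nhds hy)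

theorem contMDiffAt_frame (he : IsFrameChart P i e) (hy : y ∈ e.target) (a : Fin 4) :
    ContMDiffAt (𝓡 4) (𝓡 4).tangent ∞
      (fun x ↦ (⟨x, P.frame i a x⟩ : TangentBundle (𝓡 4) M)) (e.symm y) :=
  (P.frame_smooth i a).contMDiffAt (he.dom_mem_nhds hy)

theorem smoothNear_chartFrame (he : IsFrameChart P i e) (hy : y ∈ e.target) (a : Fin 4) :
    SmoothNear (chartFrame P i e a) y := by
  filter_upwards [e.open_target.eventually_mem hy] with z hz
  refine contMDiffAt_vectorSpace_iff_contDiffAt.1 ?_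
  exact ContMDiffAt.mpullback_vectorField_preimage (he.contMDiffAt_frame hz a)
    (he.contMDiffAt_symm hz) (he.isInvertible_chartDeriv hz) (by simp)

theorem chartDeriv_chartFrame (he : IsFrameChart P i e) (hy : y ∈ e.target) (a : Fin 4) :
    chartDeriv e y (chartFrame P i e a y) = P.frame i a (e.symm y) :=
  (he.isInvertible_chartDeriv hy).self_apply_inverse _

theorem coord_chartDeriv_frameMap (he : IsFrameChart P i e) (hy : y ∈ e.target)
    (c : Fin 4 → ℝ) (a : Fin 4) :
    P.coord i (e.symm y) (chartDeriv e y (frameMap (chartFrame P i e) y c)) a = c a := by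
  have horth b : g.inner (e.symm y) (P.frame i a (e.symm y))
      (chartDeriv e y (c b • chartFrame P i e b y)) = c b * if a = b then eta a else 0 := by
    rw [map_smul, map_smul, he.chartDeriv_chartFrame hy,
      P.frame_orthonormal i _ (he.symm_mem_dom hy), smul_eq_mul]
  rw [SpinStructure.coord, frameMap_apply, map_sum, map_sum,
    Finset.sum_congr rfl fun b _ => horth b]
  simp only [mul_ite, mul_zero, Finset.sum_ite_eq, Finset.mem_univ, if_true]
  rw [mul_left_comm, eta_mul_self, mul_one]

theorem isInvertible_frameMap (he : IsFrameChart P i e) (hy : y ∈ e.target) :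
    (frameMap (chartFrame P i e) y).IsInvertible := by
  have hinj : Function.Injective (frameMap (chartFrame P i e) y) := fun c c' h => by
    ext a
    rw [← he.coord_chartDeriv_frameMap hy c a, ← he.coord_chartDeriv_frameMap hy c' a, h]
  exact ⟨(LinearEquiv.ofInjectiveOfFinrankEq
    (frameMap (chartFrame P i e) y).toLinearMap hinj (by simp)).toContinuousLinearEquiv, rfl⟩

theorem eventually_isInvertible_frameMap (he : IsFrameChart P i e) (hy : y ∈ e.target) :
    ∀ᶠ z in 𝓝 y, (frameMap (chartFrame P i e) z).IsInvertible :=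
  (e.open_target.eventually_mem hy).mono fun _ hz => he.isInvertible_frameMap hz

theorem smoothNear_coframe (he : IsFrameChart P i e) (hy : y ∈ e.target) (a : Fin 4) :
    SmoothNear (coframe (chartFrame P i e) a) y :=
  SusyKundt.smoothNear_coframe (he.smoothNear_chartFrame hy)
    (he.eventually_isInvertible_frameMap hy) a

theorem coord_chartDeriv (he : IsFrameChart P i e) (hy : y ∈ e.target) (v : E4) (a : Fin 4) :
    P.coord i (e.symm y) (chartDeriv e y v) a = coframe (chartFrame P i e) a y v := by
  have hinv := he.isInvertible_frameMap hy
  obtain ⟨c, rfl⟩ := hinv.surjective v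
  rw [he.coord_chartDeriv_frameMap hy, coframe_apply_frameMap hinv]

theorem inner_chartDeriv_frame (he : IsFrameChart P i e) (hy : y ∈ e.target) (v : E4)
    (a : Fin 4) : g.inner (e.symm y) (chartDeriv e y v) (P.frame i a (e.symm y)) =
      eta a * coframe (chartFrame P i e) a y v := by
  rw [← he.coord_chartDeriv hy, SpinStructure.coord, ← mul_assoc, eta_mul_self, one_mul, g.symm]

theorem inner_chartDeriv (he : IsFrameChart P i e) (hy : y ∈ e.target) (v w : E4) :
    g.inner (e.symm y) (chartDeriv e y v) (chartDeriv e y w) =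
      ∑ a, eta a * (coframe (chartFrame P i e) a y v * coframe (chartFrame P i e) a y w) := by
  have hw : chartDeriv e y w =
      ∑ a, coframe (chartFrame P i e) a y w • P.frame i a (e.symm y) := by
    conv_lhs => rw [← sum_coframe_smul (he.isInvertible_frameMap hy) w]
    simp only [map_sum, map_smul, he.chartDeriv_chartFrame hy]
  simp only [hw, map_sum, map_smul, he.inner_chartDeriv_frame hy, smul_eq_mul]
  exact Finset.sum_congr rfl fun a _ => by ring

theorem inner_eq_sum_coframe (he : IsFrameChart P i e) (hx : x ∈ e.source)
    (v w : TangentSpace (𝓡 4) x) :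
    g.inner x v w = ∑ a, eta a *
      (coframe (chartFrame P i e) a (e x) (mfderiv (𝓡 4) (𝓡 4) e x v) *
        coframe (chartFrame P i e) a (e x) (mfderiv (𝓡 4) (𝓡 4) e x w)) := by
  have hback (u : TangentSpace (𝓡 4) x) :
      chartDeriv e (e x) (mfderiv (𝓡 4) (𝓡 4) e x u) = u :=
    congrArg (fun T => T u) (he.mdifferentiable.symm_comp_deriv hx)
  -- The tangent space depends on the base point, so `e.left_inv hx` cannot be rewritten with.
  have hbase z (hz : z = x) (a b : E4) : g.inner z a b = g.inner x a b := by
    subst hz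
    rfl
  have hinner := he.inner_chartDeriv (e.map_source hx) (mfderiv (𝓡 4) (𝓡 4) e x v)
    (mfderiv (𝓡 4) (𝓡 4) e x w)
  rw [hback, hback] at hinner
  exact (hbase _ (e.left_inv hx) v w).symm.trans hinner

theorem mlieBracket_frame (he : IsFrameChart P i e) (hy : y ∈ e.target) (a b : Fin 4) :
    VectorField.mlieBracket (𝓡 4) (P.frame i a) (P.frame i b) (e.symm y) =
      chartDeriv e y (VectorField.lieBracket ℝ (chartFrame P i e a) (chartFrame P i e b) y) := by
  have htwo : minSmoothness ℝ 2 ≤ ∞ := by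
    rw [minSmoothness_of_isRCLikeNormedField]
    exact WithTop.coe_le_coe.2 le_top
  have : IsManifold (𝓡 4) (minSmoothness ℝ 2) M := IsManifold.of_le htwo
  have hpull : VectorField.mpullback (𝓡 4) (𝓡 4) e.symm
        (VectorField.mlieBracket (𝓡 4) (P.frame i a) (P.frame i b)) y =
      VectorField.mlieBracket (𝓡 4) (M := E4) (chartFrame P i e a) (chartFrame P i e b) y :=
    VectorField.mpullback_mlieBracket (n := ∞)
      ((he.contMDiffAt_frame hy a).mdifferentiableAt (by simp))
      ((he.contMDiffAt_frame hy b).mdifferentiableAt (by simp)) (he.contMDiffAt_symm hy) htwo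
  rw [mlieBracket_eq_lieBracket] at hpull
  exact ((he.isInvertible_chartDeriv hy).self_apply_inverse _).symm.trans
    (congrArg (chartDeriv e y) hpull)

theorem dirDeriv_inner_frame (he : IsFrameChart P i e) (hy : y ∈ e.target) (a b : Fin 4)
    (v : TangentSpace (𝓡 4) (e.symm y)) :
    dirDeriv (fun x ↦ g.inner x (P.frame i a x) (P.frame i b x)) (e.symm y) v = 0 := by
  have hconst : (fun x ↦ g.inner x (P.frame i a x) (P.frame i b x)) =ᶠ[𝓝 (e.symm y)]
      fun _ => if a = b then eta a else 0 := by
    filter_upwards [he.dom_mem_nhds hy] with x hx using P.frame_orthonormal i x hx a b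
  rw [dirDeriv, hconst.mfderiv_eq, mfderiv_const]
  rfl

theorem koszul_frame (he : IsFrameChart P i e) (hy : y ∈ e.target) (c b a : Fin 4) :
    koszul g (P.frame i c) (P.frame i b) (P.frame i a) (e.symm y) =
      koszulCoeff (chartFrame P i e) c b a y := by
  simp only [koszul, he.dirDeriv_inner_frame hy, he.mlieBracket_frame hy,
    he.inner_chartDeriv_frame hy, koszulCoeff, structureCoeff]
  ring

theorem connection_chartDeriv (he : IsFrameChart P i e) (hy : y ∈ e.target) (v : E4)
    (a b : Fin 4) : P.connection i (e.symm y) (chartDeriv e y v) a b =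
      connForm (chartFrame P i e) a b y v := by
  simp only [SpinStructure.connection, he.coord_chartDeriv hy, he.koszul_frame hy, connForm,
    frameForm_apply, mul_comm]

theorem smoothNear_comp (he : IsFrameChart P i e) (hy : y ∈ e.target) (ε : P.Spinor) :
    SmoothNear (fun y => ε.comp i (e.symm y)) y := by
  filter_upwards [e.open_target.eventually_mem hy] with z hz
  rw [← contMDiffAt_iff_contDiffAt]
  exact ((ε.smooth i).contMDiffAt (he.dom_mem_nhds hz)).comp z (he.contMDiffAt_symm hz)

theorem fderiv_comp (he : IsFrameChart P i e) (hy : y ∈ e.target) (ε : P.Spinor) (v : E4) :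
    fderiv ℝ (fun y => ε.comp i (e.symm y)) y v =
      mfderiv (𝓡 4) 𝓘(ℝ, Fin 4 → ℝ) (ε.comp i) (e.symm y) (chartDeriv e y v) := by
  rw [← mfderiv_eq_fderiv]
  exact mfderiv_comp_apply y
    (((ε.smooth i).contMDiffAt (he.dom_mem_nhds hy)).mdifferentiableAt (by simp))
    ((he.contMDiffAt_symm hy).mdifferentiableAt (by simp)) v

theorem fderiv_comp_eq_killingDeriv (he : IsFrameChart P i e) (hy : y ∈ e.target)
    (hε : ε.IsKilling lam) (v : E4) :
    fderiv ℝ (fun y => ε.comp i (e.symm y)) y v =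
      killingDeriv lam (fun c => coframe (chartFrame P i e) c y v)
        (fun a b => connForm (chartFrame P i e) a b y v) (ε.comp i (e.symm y)) := by
  have hcoord : P.coord i (e.symm y) (chartDeriv e y v) =
      fun c => coframe (chartFrame P i e) c y v := funext (he.coord_chartDeriv hy v)
  have hkilling := hε.killing i _ (he.symm_mem_dom hy) (chartDeriv e y v)
  simp only [SpinStructure.Spinor.covDeriv, SpinStructure.Spinor.cliffordMul,
    he.connection_chartDeriv hy, hcoord] at hkilling
  rw [he.fderiv_comp hy, killingDeriv]
  exact eq_sub_of_add_eq hkilling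

theorem isKillingFrame (he : IsFrameChart P i e) (hy : y ∈ e.target) (hε : ε.IsKilling lam) :
    IsKillingFrame lam (coframe (chartFrame P i e))
      (fun a b => connForm (chartFrame P i e) a b y) (fun y => ε.comp i (e.symm y)) y :=
  ⟨fun v a b => connForm_antisymm a b y v,
    extD_coframe (fun a => (he.smoothNear_chartFrame hy a).differentiableAt)
      (fun a => (he.smoothNear_coframe hy a).differentiableAt)
      (he.eventually_isInvertible_frameMap hy),
    he.fderiv_comp_eq_killingDeriv hy hε⟩

section KundtChart

variable {H : ℝ → (Fin 2 → ℝ) → ℝ} {Θ : OpenPartialHomeomorph E4 E4}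
  (he : IsFrameChart P i e)
  (hΘ : IsKundtChart lam (fun y v w => ∑ a, eta a *
    (coframe (chartFrame P i e) a y v * coframe (chartFrame P i e) a y w)) H Θ)

include he hΘ

theorem contMDiffOn_trans : ContMDiffOn (𝓡 4) (𝓡 4) ∞ (e.trans Θ) (e.trans Θ).source := by
  have h : ContMDiffOn (𝓡 4) (𝓡 4) ∞ Θ Θ.source := fun x hx =>
    (hΘ.contDiffAt x hx).contMDiffAt.contMDiffWithinAt
  rw [e.coe_trans, e.trans_source]
  exact h.comp (he.contMDiffOn.mono inter_subset_left) fun x hx => hx.2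

theorem contMDiffOn_trans_symm :
    ContMDiffOn (𝓡 4) (𝓡 4) ∞ (e.trans Θ).symm (e.trans Θ).target := by
  have h : ContMDiffOn (𝓡 4) (𝓡 4) ∞ Θ.symm Θ.target := fun y hy =>
    (hΘ.contDiffAt_symm y hy).contMDiffAt.contMDiffWithinAt
  rw [e.coe_trans_symm, e.trans_target]
  exact he.contMDiffOn_symm.comp (h.mono inter_subset_left) fun y hy => hy.2

theorem inner_eq_kundtMetric (hx : x ∈ (e.trans Θ).source) (v w : TangentSpace (𝓡 4) x) :
    g.inner x v w =
      kundtMetric lam H (fun _ y => y 0) (fun _ y => y 1) (fun _ _ => 0) (e.trans Θ x)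
        (mfderiv (𝓡 4) (𝓡 4) (e.trans Θ) x v) (mfderiv (𝓡 4) (𝓡 4) (e.trans Θ) x w) := by
  rw [e.trans_source] at hx
  have hderiv (u : TangentSpace (𝓡 4) x) : mfderiv (𝓡 4) (𝓡 4) (e.trans Θ) x u =
      fderiv ℝ Θ (e x) (mfderiv (𝓡 4) (𝓡 4) e x u) := by
    rw [← mfderiv_eq_fderiv]
    exact mfderiv_comp_apply x ((hΘ.contDiffAt _ hx.2).contMDiffAt.mdifferentiableAt (by simp))
      (he.mdifferentiable.mdifferentiableAt hx.1) u
  rw [hderiv, hderiv]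
  exact (he.inner_eq_sum_coframe hx.1 v w).trans (hΘ.metric_eq _ hx.2 _ _)

end KundtChart

end IsFrameChart

namespace SpinStructure.Spinor

theorem comp_eq_zero (ε : P.Spinor) {i j : ι} {x : M} (hi : x ∈ P.dom i)
    (hj : x ∈ P.dom j) (h : ε.comp j x = 0) : ε.comp i x = 0 := by
  rw [ε.compat i j x ⟨hi, hj⟩, h, Matrix.mulVec_zero]

namespace IsKilling

theorem eventually_comp_eq_zero (hε : ε.IsKilling lam) {x : M} (hx : x ∈ P.dom i)
    (h0 : ε.comp i x = 0) : ∀ᶠ z in 𝓝 x, ε.comp i z = 0 := by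
  obtain ⟨e, he, hxe⟩ := exists_isFrameChart P hx
  have hy := e.map_source hxe
  have hzero := eventually_eq_zero_of_killing (lam := lam)
    (fun a => (he.smoothNear_coframe hy a).continuousAt)
    (fun a b => (smoothNear_connForm (he.smoothNear_chartFrame hy)
      (he.eventually_isInvertible_frameMap hy) a b).continuousAt)
    (he.smoothNear_comp hy ε).eventually_differentiableAt
    ((e.open_target.eventually_mem hy).mono fun z hz => he.fderiv_comp_eq_killingDeriv hz hε)
    (by simpa only [e.left_inv hxe] using h0)
  filter_upwards [(e.continuousAt hxe).eventually hzero, e.open_source.mem_nhds hxe] with z hz hze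
  rwa [e.left_inv hze] at hz

theorem comp_ne_zero [PreconnectedSpace M] (hε : ε.IsKilling lam) {x : M} (hx : x ∈ P.dom i) :
    ε.comp i x ≠ 0 := by
  let Z : Set M := {x | ∀ j, x ∈ P.dom j → ε.comp j x = 0}
  have hZ {j x} (hj : x ∈ P.dom j) (h : ε.comp j x = 0) : x ∈ Z := fun k hk =>
    ε.comp_eq_zero hk hj h
  have hopen : IsOpen Z := isOpen_iff_mem_nhds.2 fun x hxZ => by
    obtain ⟨j, hj⟩ := P.cover x
    filter_upwards [hε.eventually_comp_eq_zero hj (hxZ j hj), (P.isOpen_dom j).mem_nhds hj]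
      with z hz hzj using hZ hzj hz
  have hopen_compl : IsOpen Zᶜ := isOpen_iff_mem_nhds.2 fun x hxZ => by
    obtain ⟨j, hj⟩ := P.cover x
    have hmem := (P.isOpen_dom j).mem_nhds hj
    filter_upwards [((ε.smooth j).continuousOn.continuousAt hmem).eventually_ne
      fun h => hxZ (hZ hj h), hmem] with z hz hzj hzZ using hz (hzZ j hzj)
  intro h
  have huniv : Z = univ := IsClopen.eq_univ ⟨isOpen_compl_iff.1 hopen_compl, hopen⟩ ⟨x, hZ hx h⟩
  obtain ⟨j, z, hz, hne⟩ := hε.nontrivial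
  exact hne (huniv.ge (mem_univ z) j hz)

end IsKilling

end SpinStructure.Spinor

end FrameChart

end SusyKundt

end

theorem mainTheorem2_general {M : Type*} [TopologicalSpace M] [PreconnectedSpace M]
    [ChartedSpace (EuclideanSpace ℝ (Fin 4)) M] [IsManifold (𝓡 4) ∞ M]
    (g : LorentzianMetric M) {ι : Type*} (P : SpinStructure g ι) (ε : P.Spinor) (lam : ℝ)
    (hε : ε.IsKilling lam) (p : M) :
    ∃ H : ℝ → (Fin 2 → ℝ) → ℝ, ContDiff ℝ ∞ (fun z : ℝ × (Fin 2 → ℝ) => H z.1 z.2) ∧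
      ∃ φ : OpenPartialHomeomorph M (EuclideanSpace ℝ (Fin 4)), p ∈ φ.source ∧
        ContMDiffOn (𝓡 4) (𝓡 4) ∞ φ φ.source ∧ ContMDiffOn (𝓡 4) (𝓡 4) ∞ φ.symm φ.target ∧
        ∀ x ∈ φ.source, ∀ v w : TangentSpace (𝓡 4) x,
          g.inner x v w =
            kundtMetric lam H (fun _ y => y 0) (fun _ y => y 1) (fun _ _ => 0) (φ x)
              (mfderiv (𝓡 4) (𝓡 4) φ x v) (mfderiv (𝓡 4) (𝓡 4) φ x w) := by
  obtain ⟨i, hi⟩ := P.cover p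
  obtain ⟨e, he, hpe⟩ := exists_isFrameChart P hi
  have hy := e.map_source hpe
  have hinv := he.isInvertible_frameMap hy
  obtain ⟨H, hH, Θ, hpΘ, hΘ⟩ := exists_isKundtChart_of_isKillingFrame hε.const_ne_zero
    (he.smoothNear_coframe hy) (he.smoothNear_comp hy ε)
    (by simpa only [e.left_inv hpe] using hε.comp_ne_zero hi)
    (fun v hv => by simpa [hv] using (sum_coframe_smul hinv v).symm)
    (fun t => ⟨frameMap (chartFrame P i e) (e p) t, fun a => coframe_apply_frameMap hinv a t⟩)
    ((e.open_target.eventually_mem hy).mono fun z hz => ⟨_, he.isKillingFrame hz hε⟩)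
  exact ⟨H, hH, e.trans Θ, by simp [hpe, hpΘ], he.contMDiffOn_trans hΘ,
    he.contMDiffOn_trans_symm hΘ, fun x hx => he.inner_eq_kundtMetric hΘ hx⟩

theorem mainTheorem2 {M : Type*} [TopologicalSpace M] [T2Space M] [SecondCountableTopology M]
    [ConnectedSpace M] [ChartedSpace (EuclideanSpace ℝ (Fin 4)) M] [IsManifold (𝓡 4) ∞ M]
    (g : LorentzianMetric M) {ι : Type*} (P : SpinStructure g ι) (ε : P.Spinor) (lam : ℝ)
    (hε : ε.IsKilling lam) (p : M) :
    ∃ (H F G : ℝ → (Fin 2 → ℝ) → ℝ) (β : ℝ → (Fin 2 → ℝ) → (Fin 2 → ℝ)),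
      ContDiff ℝ ∞ (fun z : ℝ × (Fin 2 → ℝ) ↦ H z.1 z.2) ∧
      ContDiff ℝ ∞ (fun z : ℝ × (Fin 2 → ℝ) ↦ F z.1 z.2) ∧
      ContDiff ℝ ∞ (fun z : ℝ × (Fin 2 → ℝ) ↦ G z.1 z.2) ∧
      ContDiff ℝ ∞ (fun z : ℝ × (Fin 2 → ℝ) ↦ β z.1 z.2) ∧
      (∀ u y, LinearIndependent ℝ ![dX (F u) y, dX (G u) y]) ∧
      BetaEquation lam F G β ∧
      ∃ φ : OpenPartialHomeomorph M (EuclideanSpace ℝ (Fin 4)),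
        p ∈ φ.source ∧
        ContMDiffOn (𝓡 4) (𝓡 4) ∞ φ φ.source ∧
        ContMDiffOn (𝓡 4) (𝓡 4) ∞ φ.symm φ.target ∧
        ∀ x ∈ φ.source, ∀ v w : TangentSpace (𝓡 4) x,
          g.inner x v w =
            kundtMetric lam H F G β (φ x)
              (mfderiv (𝓡 4) (𝓡 4) φ x v) (mfderiv (𝓡 4) (𝓡 4) φ x w) := by
  obtain ⟨H, hH, hφ⟩ := mainTheorem2_general g P ε lam hε p
  exact ⟨H, fun _ y => y 0, fun _ y => y 1, fun _ _ => 0, hH,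
    (contDiff_apply ℝ ℝ (0 : Fin 2)).comp contDiff_snd,
    (contDiff_apply ℝ ℝ (1 : Fin 2)).comp contDiff_snd, contDiff_const,
    fun _ => linearIndependent_dX_coord, betaEquation_coord lam, hφ⟩
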